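/- Let $\mathcal V$ be a countable (finite or countably infinite) set with all subsets measurable, and let $k\ge 1$. A $k$-hypergraph on $\mathcal V$ is a set $g\subseteq\mathcal V^k$ (identified with its indicator function) that is invariant under permutations of the coordinates; a $k$-distinguishing class $\mathcal G$ is a set of $k$-hypergraphs on $\mathcal V$. For $v\in\mathcal V$ put $g_v(u_1,\dots,u_{k-1})=g(v,u_1,\dots,u_{k-1})$ and $\mathcal G_v=\{g_v: g\in\mathcal G\}$. The graph VC dimension is $\mathrm{gVC}(\mathcal G)=\mathrm{VC}(\mathcal G)$ for $k=1$ and $\mathrm{gVC}(\mathcal G)=\sup_{v\in\mathcal V}\mathrm{gVC}(\mathcal G_v)$ for $k>1$. For a probability distribution $p$ on $\mathcal V$ let $L_p(g)=p^k(g)$, and let $\mathrm{IPM}_{\mathcal G}(p_1,p_2)=\sup_{g\in\mathcal G}|L_{p_1}(g)-L_{p_2}(g)|$. Consider (possibly randomized) algorithms that receive $n_1$ IID samples from $p_1$ and, independently, $n_2$ IID samples from $p_2$. A $\mathcal G$-discriminating algorithm with accuracy $\epsilon$ that succeeds with probability $1-\delta$ outputs some $g\in\mathcal G$ such that, for all distributions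 $p_1,p_2$ on $\mathcal V$, with probability at least $1-\delta$ (over the samples and the internal randomness) $$|L_{p_1}(g)-L_{p_2}(g)|>\mathrm{IPM}_{\mathcal G}(p_1,p_2)-\epsilon .$$ A testing algorithm for $\mathcal G$ with accuracy $\epsilon$ that succeeds with probability $1-\delta$ outputs EQUIVALENT or DISTINCT such that, for all $p_1,p_2$, with probability at least $1-\delta$ it outputs EQUIVALENT if $p_1=p_2$, and with probability at least $1-\delta$ it outputs DISTINCT if $\mathrm{IPM}_{\mathcal G}(p_1,p_2)>\epsilon$. **Theorem.** There are absolute constants $c>0$ and $a\in\mathbb N$ such that the following holds for every such $\mathcal V$, every $k\ge1$, every $k$-distinguishing class $\mathcal G$ on $\mathcal V$ with $\mathrm{gVC}(\mathcal G)=\rho<\infty$, every $0<\epsilon\le 2^{-3k^3}$ and all $n_1,n_2\ge 0$. 1. If $\rho\ge 2^{a k^3}$, then every $\mathcal G$-discriminating algorithm with accuracy $\epsilon$ that succeeds with probability $1-\frac{2^{-k\log_2 k}}{3}$ and uses $n_1$ and $n_2$ samples satisfies $$n_1+n_2\ \ge\ c\,\frac{\sqrt\rho}{2^{7k^3}\epsilon^2}.$$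 2. If $\rho\ge 2$ and $\delta<\frac{2^{-k\log_2 k}}{3}$, then every testing algorithm for $\mathcal G$ with accuracy $\epsilon$ that succeeds with probability $1-\delta$ and uses $n_1$ and $n_2$ samples satisfies the same bound. -/

import Mathlib

open MeasureTheory

namespace GraphDisc

/-- An undirected `k`-hypergraph on the vertex set `V` (a `k`-distinguisher): a set of `k`-tuples
of vertices which is invariant under permutations of the coordinates. -/
@[ext]
structure Hypergraph (V : Type*) (k : ℕ) where
  edges : Set (Fin k → V)
  symmetric : ∀ (π : Equiv.Perm (Fin k)) (u : Fin k → V), u ∘ π ∈ edges ↔ u ∈ edges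

namespace Hypergraph

/-- The `k`-hypergraph `g_v` obtained from a `(k+1)`-hypergraph `g` by fixing the first vertex of
an edge to be `v`, i.e. `g_v(u₁, …, u_k) = g(v, u₁, …, u_k)`. -/
def link {V : Type*} {k : ℕ} (v : V) (g : Hypergraph V (k + 1)) : Hypergraph V k where
  edges := {u | (Fin.cons v u : Fin (k + 1) → V) ∈ g.edges}
  symmetric := by
    intro π u
    have h : (Fin.cons v (u ∘ π) : Fin (k + 1) → V)
        = (Fin.cons v u : Fin (k + 1) → V) ∘ (Equiv.Perm.decomposeFin.symm (0, π)) := by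
      funext i
      refine Fin.cases ?_ (fun j => ?_) i
      · simp
      · simp
    simp only [Set.mem_ofPred_eq, h]
    exact g.symmetric _ _

/-- The `σ`-algebra on hypergraphs generated by the events `u` is an edge of `g`. -/
instance {V : Type*} {k : ℕ} : MeasurableSpace (Hypergraph V k) :=
  MeasurableSpace.generateFrom {E | ∃ u : Fin k → V, E = {g | u ∈ g.edges}}

/-- The frequency `L_P(g) = P^k(E_g)` of an edge of `g` with respect to `P`. -/
noncomputable def freq {V : Type*} [MeasurableSpace V] {k : ℕ}
    (P : Measure V) (g : Hypergraph V k) : ℝ :=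
  (Measure.pi (fun _ : Fin k => P)).real g.edges

end Hypergraph

/-- The family `𝒟` of subsets of `V` shatters the finite set `S`. -/
def Shatters {V : Type*} (𝒟 : Set (Set V)) (S : Finset V) : Prop :=
  ∀ T : Set V, T ⊆ ↑S → ∃ d ∈ 𝒟, d ∩ ↑S = T

/-- The VC dimension of a family of subsets of `V`: the supremum of the sizes of the finite sets
that it shatters. -/
noncomputable def vcDim {V : Type*} (𝒟 : Set (Set V)) : ℕ∞ :=
  ⨆ (S : Finset V) (_ : Shatters 𝒟 S), (S.card : ℕ∞)

/-- The graph VC dimension of a class of `k`-hypergraphs. A `1`-hypergraph is identified with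
a subset of `V`. The value for `k = 0` is a placeholder. -/
noncomputable def gVC {V : Type*} : (k : ℕ) → Set (Hypergraph V k) → ℕ∞
  | 0, _ => 0
  | 1, 𝒢 => vcDim ((fun g : Hypergraph V 1 => {x : V | (fun _ => x) ∈ g.edges}) '' 𝒢)
  | k + 2, 𝒢 => ⨆ v : V, gVC (k + 1) (Hypergraph.link v '' 𝒢)

/-- The integral probability metric
`IPM_𝒢(p₁, p₂) = sup_{g ∈ 𝒢} |L_{p₁}(g) - L_{p₂}(g)|`. -/
noncomputable def ipm {V : Type*} [MeasurableSpace V] {k : ℕ} (𝒢 : Set (Hypergraph V k))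
    (p₁ p₂ : Measure V) : ℝ :=
  ⨆ g : 𝒢, |g.1.freq p₁ - g.1.freq p₂|

/-- A (possibly randomized) algorithm that reads two samples, of sizes `n₁` and `n₂`, and returns
an element of `Out`: to every pair of samples it assigns the law of its output. Deterministic
algorithms are those whose output laws are Dirac measures. -/
abbrev Algorithm (V : Type*) (n₁ n₂ : ℕ) (Out : Type*) [MeasurableSpace Out] :=
  (Fin n₁ → V) → (Fin n₂ → V) → ProbabilityMeasure Out

/-- The probability that the output of `A` lies in `E` when its two samples are drawn
independently, IID from `p₁` and IID from `p₂`. -/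
noncomputable def Algorithm.prob {V : Type*} [MeasurableSpace V] {n₁ n₂ : ℕ} {Out : Type*}
    [MeasurableSpace Out] (A : Algorithm V n₁ n₂ Out) (p₁ p₂ : Measure V) (E : Set Out) :
    ENNReal :=
  ∫⁻ S : (Fin n₁ → V) × (Fin n₂ → V), (A S.1 S.2 : Measure Out) E
    ∂((Measure.pi (fun _ : Fin n₁ => p₁)).prod (Measure.pi (fun _ : Fin n₂ => p₂)))

/-- `A` is a `𝒢`-discriminating algorithm with accuracy `ε` and confidence `1 - δ`: whatever the
distributions `p₁`, `p₂` are, with probability at least `1 - δ` its output `g ∈ 𝒢` satisfies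
`|L_{p₁}(g) - L_{p₂}(g)| > IPM_𝒢(p₁, p₂) - ε`. -/
def IsDiscriminating {V : Type*} [MeasurableSpace V] {k n₁ n₂ : ℕ} (𝒢 : Set (Hypergraph V k))
    (A : Algorithm V n₁ n₂ 𝒢) (ε δ : ℝ) : Prop :=
  ∀ p₁ p₂ : Measure V, IsProbabilityMeasure p₁ → IsProbabilityMeasure p₂ →
    ENNReal.ofReal (1 - δ) ≤
      A.prob p₁ p₂ {g | |g.1.freq p₁ - g.1.freq p₂| > ipm 𝒢 p₁ p₂ - ε}

/-- The two possible answers of a testing algorithm. -/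
inductive Verdict
  | equivalent
  | distinct

instance : MeasurableSpace Verdict := ⊤

/-- `A` is a testing algorithm for `𝒢` with accuracy `ε` and confidence `1 - δ`. -/
def IsTesting {V : Type*} [MeasurableSpace V] {k n₁ n₂ : ℕ} (𝒢 : Set (Hypergraph V k))
    (A : Algorithm V n₁ n₂ Verdict) (ε δ : ℝ) : Prop :=
  ∀ p₁ p₂ : Measure V, IsProbabilityMeasure p₁ → IsProbabilityMeasure p₂ →
    (p₁ = p₂ → ENNReal.ofReal (1 - δ) ≤ A.prob p₁ p₂ {Verdict.equivalent}) ∧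
    (ipm 𝒢 p₁ p₂ > ε → ENNReal.ofReal (1 - δ) ≤ A.prob p₁ p₂ {Verdict.distinct})

end GraphDisc

namespace GraphDisc

/-! Unrolling the graph VC dimension yields `k - 1` fixed vertices `v` and a set of at least `ρ`
vertices `x` such that the tuples `(x, v)` cut out every subset of it. Split it into `m ≈ ρ/2` pairs
and compare the uniform weights with their perturbations by `±τ` inside each pair, the signs `σ`
being unknown. Averaging over `σ`, the likelihood ratio has second moment at most `exp (n² τ⁴ /
(2m))`, so a statistic of `n` draws detects the perturbation only if `n² τ⁴ ≳ m`
(`card_sq_lower_bound`).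

The hypergraph that selects the favoured point of each pair sees a gap `τ/2` in the first
coordinate, but `p^k` draws all coordinates from the same law. So the draw is mixed with point
masses at `v`, uniformly over a set `A` of options. Polarization over `A` isolates the edges that
use each option exactly once, and some `A` keeps the gap up to a factor `2^(k-1) k^k`
(`exists_freq_mix_sub_ge`). This `A` depends on `σ`, so the tests for all `2^(k-1)` sets are added
up, which is why the failure probability has to be small in `k`.

The null mixture is known, so a test can simulate the first sample. A discriminating algorithm
becomes a test by estimating the frequency of its output on fresh tuples; for large `ρ` their cost
is absorbed into the bound. -/

/-! ### Finite product expectations and Chebyshev's inequality. -/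

/-- The expectation of `f` under `|ι|` independent draws from the weights `w`. -/
noncomputable def iidSum {ι Y : Type*} [Fintype ι] [DecidableEq ι] [Fintype Y] (w : Y → ℝ)
    (f : (ι → Y) → ℝ) : ℝ :=
  ∑ s : ι → Y, (∏ i, w (s i)) * f s

/-- `w` is a vector of probabilities. -/
structure IsWeight {Y : Type*} [Fintype Y] (w : Y → ℝ) : Prop where
  nonneg : ∀ y, 0 ≤ w y
  sum_eq_one : ∑ y, w y = 1

section iid

variable {ι Y : Type*} [Fintype ι] [DecidableEq ι] [Fintype Y] {w : Y → ℝ}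

theorem sum_prod_eq_prod_sum (F : ι → Y → ℝ) :
    ∑ s : ι → Y, ∏ i, F i (s i) = ∏ i, ∑ y, F i y := by
  rw [Finset.prod_univ_sum, Fintype.piFinset_univ]

theorem IsWeight.iid (hw : IsWeight w) : IsWeight (fun s : ι → Y => ∏ i, w (s i)) where
  nonneg s := Finset.prod_nonneg fun i _ => hw.nonneg _
  sum_eq_one := by
    rw [sum_prod_eq_prod_sum (fun _ => w)]
    simp [hw.sum_eq_one]

theorem iidSum_const (hw : IsWeight w) (c : ℝ) : iidSum (ι := ι) w (fun _ => c) = c := by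
  rw [iidSum, ← Finset.sum_mul, hw.iid.sum_eq_one, one_mul]

theorem iidSum_mono (hw : IsWeight w) {f g : (ι → Y) → ℝ} (h : ∀ s, f s ≤ g s) :
    iidSum w f ≤ iidSum w g :=
  Finset.sum_le_sum fun s _ => mul_le_mul_of_nonneg_left (h s) (hw.iid.nonneg s)

theorem iidSum_add (f g : (ι → Y) → ℝ) :
    iidSum w (fun s => f s + g s) = iidSum w f + iidSum w g := by
  simp [iidSum, mul_add, Finset.sum_add_distrib]

theorem iidSum_sum {κ : Type*} (t : Finset κ) (f : κ → (ι → Y) → ℝ) :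
    iidSum w (fun s => ∑ a ∈ t, f a s) = ∑ a ∈ t, iidSum w (f a) := by
  simp only [iidSum, Finset.mul_sum]
  exact Finset.sum_comm

theorem iidSum_mul_left (c : ℝ) (f : (ι → Y) → ℝ) :
    iidSum w (fun s => c * f s) = c * iidSum w f := by
  simp only [iidSum, Finset.mul_sum]
  exact Finset.sum_congr rfl fun s _ => by ring

theorem iidSum_nonneg (hw : IsWeight w) {f : (ι → Y) → ℝ} (h : ∀ s, 0 ≤ f s) :
    0 ≤ iidSum w f :=
  Finset.sum_nonneg fun s _ => mul_nonneg (hw.iid.nonneg s) (h s)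

theorem iidSum_le (hw : IsWeight w) {f : (ι → Y) → ℝ} {c : ℝ} (h : ∀ s, f s ≤ c) :
    iidSum w f ≤ c :=
  (iidSum_mono hw h).trans_eq (iidSum_const hw c)

theorem le_iidSum (hw : IsWeight w) {f : (ι → Y) → ℝ} {c : ℝ} (h : ∀ s, c ≤ f s) :
    c ≤ iidSum w f :=
  (iidSum_const hw c).symm.trans_le (iidSum_mono hw h)

theorem iidSum_comm {κ Z : Type*} [Fintype κ] [DecidableEq κ] [Fintype Z] {w' : Z → ℝ}
    (f : (ι → Y) → (κ → Z) → ℝ) :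
    iidSum w (fun s => iidSum w' (f s)) = iidSum w' (fun t => iidSum w (fun s => f s t)) := by
  simp only [iidSum, Finset.mul_sum]
  rw [Finset.sum_comm]
  exact Finset.sum_congr rfl fun s _ => Finset.sum_congr rfl fun t _ => by ring

theorem iidSum_prod {Z : Type*} [Fintype Z] {w' : Z → ℝ} (f : (ι → Y × Z) → ℝ) :
    iidSum (fun y : Y × Z => w y.1 * w' y.2) f =
      iidSum w (fun s => iidSum w' (fun t => f (fun i => (s i, t i)))) := by
  simp only [iidSum, Finset.mul_sum]
  rw [← Fintype.sum_prod_type' (f := fun (s : ι → Y) (t : ι → Z) =>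
    (∏ i, w (s i)) * ((∏ i, w' (t i)) * f (fun i => (s i, t i))))]
  refine Fintype.sum_equiv (Equiv.arrowProdEquivProdArrow ι (fun _ => Y) (fun _ => Z)) _ _
    fun s => ?_
  simp [Equiv.arrowProdEquivProdArrow, Finset.prod_mul_distrib, mul_assoc]

theorem iidSum_sumType {κ : Type*} [Fintype κ] [DecidableEq κ] (f : (ι ⊕ κ → Y) → ℝ) :
    iidSum w f = iidSum w (fun s : ι → Y => iidSum w (fun t : κ → Y => f (Sum.elim s t))) := by
  simp only [iidSum, Finset.mul_sum]
  rw [← Fintype.sum_prod_type' (f := fun (s : ι → Y) (t : κ → Y) =>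
    (∏ i, w (s i)) * ((∏ i, w (t i)) * f (Sum.elim s t)))]
  refine Fintype.sum_equiv (Equiv.sumArrowEquivProdArrow ι κ Y) _ _ fun s => ?_
  simp [Equiv.sumArrowEquivProdArrow, mul_assoc]

theorem iidSum_curry {κ : Type*} [Fintype κ] [DecidableEq κ] (f : (ι × κ → Y) → ℝ) :
    iidSum w f = iidSum (fun s : κ → Y => ∏ j, w (s j)) (fun t : ι → κ → Y => f (fun i => t i.1 i.2))
    := by
  simp only [iidSum]
  refine Fintype.sum_equiv (Equiv.curry ι κ Y) _ _ fun s => ?_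
  simp [Fintype.prod_prod_type, Function.curry]

end iid

theorem IsWeight.prod {Y Z : Type*} [Fintype Y] [Fintype Z] {w : Y → ℝ} {w' : Z → ℝ}
    (hw : IsWeight w) (hw' : IsWeight w') : IsWeight (fun y : Y × Z => w y.1 * w' y.2) where
  nonneg y := mul_nonneg (hw.nonneg _) (hw'.nonneg _)
  sum_eq_one := by
    rw [Fintype.sum_prod_type]
    simp [← Finset.mul_sum, hw.sum_eq_one, hw'.sum_eq_one]

/-- The second moment of a sum of `M` independent centred variables. -/
theorem iidSum_sq_sum {B : Type*} [Fintype B] {q : B → ℝ} (hq : IsWeight q) (h : B → ℝ)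
    (hmean : ∑ b, q b * h b = 0) (M : ℕ) :
    iidSum (ι := Fin M) q (fun t => (∑ j, h (t j)) ^ 2) = M * ∑ b, q b * h b ^ 2 := by
  have hz : ∀ M : ℕ, iidSum (ι := Fin M) q (fun t => ∑ j, h (t j)) = 0 := by
    intro M
    rw [iidSum_sum]
    refine Finset.sum_eq_zero fun j _ => ?_
    -- Absorbing `h` into coordinate `j` makes the expectation a product whose `j`-th factor is the
    -- zero mean.
    have := sum_prod_eq_prod_sum (fun (i : Fin M) (b : B) => if i = j then q b * h b else q b)
    rw [Finset.prod_eq_zero (Finset.mem_univ j) (by simpa using hmean)] at this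
    rw [← this, iidSum]
    refine Finset.sum_congr rfl fun s _ => ?_
    rw [← Finset.mul_prod_erase _ _ (Finset.mem_univ j),
      ← Finset.mul_prod_erase _ (fun i => if i = j then q (s i) * h (s i) else q (s i))
        (Finset.mem_univ j)]
    rw [Finset.prod_congr rfl (g := fun i => q (s i))
      (f := fun i => if i = j then q (s i) * h (s i) else q (s i))]
    · simp; ring
    · intro i hi
      simp [Finset.ne_of_mem_erase hi]
  induction M with
  | zero => simp [iidSum]
  | succ M ih =>
    have hstep : iidSum (ι := Fin (M + 1)) q (fun t => (∑ j, h (t j)) ^ 2) =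
        ∑ b, q b * iidSum (ι := Fin M) q (fun t => h b ^ 2 + (2 * h b * ∑ j, h (t j) +
          (∑ j, h (t j)) ^ 2)) := by
      simp only [iidSum, Finset.mul_sum]
      rw [← Fintype.sum_prod_type' (f := fun (b : B) (t : Fin M → B) =>
        q b * ((∏ i, q (t i)) * (h b ^ 2 + (∑ j, 2 * h b * h (t j) + (∑ j, h (t j)) ^ 2))))]
      refine Fintype.sum_equiv (Fin.consEquiv (fun _ => B)).symm _ _ fun s => ?_
      simp only [Fin.consEquiv, Equiv.coe_fn_symm_mk, Fin.prod_univ_succ, Fin.sum_univ_succ,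
        Fin.tail, ← Finset.mul_sum]
      ring
    rw [hstep]
    simp only [iidSum_add, iidSum_mul_left, hz, iidSum_const hq, ih, mul_zero, zero_add]
    simp only [mul_add, Finset.sum_add_distrib, ← Finset.sum_mul, hq.sum_eq_one]
    push_cast
    ring

/-- Chebyshev's inequality for the mean of `M` independent copies of a `[0, 1]`-valued variable. -/
theorem iidSum_deviation_le {B : Type*} [Fintype B] {q : B → ℝ} (hq : IsWeight q) (h : B → ℝ)
    (h0 : ∀ b, 0 ≤ h b) (h1 : ∀ b, h b ≤ 1) {M : ℕ} (hM : 0 < M) {ε : ℝ} (hε : 0 < ε) :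
    iidSum (ι := Fin M) q
      ({t | ε < |(∑ j, h (t j)) / M - ∑ b, q b * h b|}.indicator 1) ≤ 1 / (M * ε ^ 2) := by
  set μ := ∑ b, q b * h b with hμ
  have hM' : (0 : ℝ) < M := by exact_mod_cast hM
  have hμ0 : 0 ≤ μ := Finset.sum_nonneg fun b _ => mul_nonneg (hq.nonneg b) (h0 b)
  have hμ1 : μ ≤ 1 := by
    rw [← hq.sum_eq_one]
    exact Finset.sum_le_sum fun b _ => mul_le_of_le_one_right (hq.nonneg b) (h1 b)
  have hmean : ∑ b, q b * (h b - μ) = 0 := by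
    simp [mul_sub, Finset.sum_sub_distrib, ← Finset.sum_mul, hq.sum_eq_one, hμ]
  have hvar : ∑ b, q b * (h b - μ) ^ 2 ≤ 1 := by
    rw [← hq.sum_eq_one]
    refine Finset.sum_le_sum fun b _ => mul_le_of_le_one_right (hq.nonneg b) ?_
    nlinarith [h0 b, h1 b]
  calc _ ≤ iidSum (ι := Fin M) q
        (fun t => 1 / (M * ε) ^ 2 * (∑ j, (h (t j) - μ)) ^ 2) := by
        refine iidSum_mono hq fun t => ?_
        by_cases ht : ε < |(∑ j, h (t j)) / M - μ|
        · rw [Set.indicator_of_mem (by exact ht)]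
          have : (∑ j, (h (t j) - μ)) = M * ((∑ j, h (t j)) / M - μ) := by
            simp [Finset.sum_sub_distrib]; field_simp
          rw [this, mul_pow, mul_pow, ← sq_abs ((∑ j, h (t j)) / M - μ), Pi.one_apply,
            div_mul_eq_mul_div, one_mul, le_div_iff₀ (by positivity), one_mul]
          gcongr
        · rw [Set.indicator_of_notMem (by exact ht)]
          positivity
    _ = 1 / (M * ε) ^ 2 * (M * ∑ b, q b * (h b - μ) ^ 2) := by
        rw [iidSum_mul_left, iidSum_sq_sum hq _ hmean]
    _ ≤ 1 / (M * ε) ^ 2 * (M * 1) := by gcongr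
    _ = _ := by field_simp

/-! ### Second-moment lower bound for randomly perturbed uniform weights. -/

/-- The real number `1` or `-1` encoded by a Boolean. -/
def sgn (b : Bool) : ℝ := if b then 1 else -1

/-- The uniform weights on `Fin m × Bool`, perturbed by `±τ` in each pair of points. -/
noncomputable def perturbed (m : ℕ) (τ : ℝ) (σ : Fin m → Bool) (x : Fin m × Bool) : ℝ :=
  (1 + τ * (sgn (σ x.1) * sgn x.2)) / (2 * m)

/-- The uniform weights on `Fin m × Bool`. -/
noncomputable def uniform (m : ℕ) (_ : Fin m × Bool) : ℝ := 1 / (2 * m)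

theorem sgn_mul_self (b : Bool) : sgn b * sgn b = 1 := by cases b <;> simp [sgn]

theorem sum_sgn : ∑ b, sgn b = 0 := by simp [sgn]

theorem isWeight_perturbed {m : ℕ} (hm : 0 < m) {τ : ℝ} (h0 : 0 ≤ τ) (h1 : τ ≤ 1)
    (σ : Fin m → Bool) : IsWeight (perturbed m τ σ) where
  nonneg x := by
    refine div_nonneg ?_ (by positivity)
    rcases x with ⟨i, b⟩
    dsimp only
    cases b <;> cases σ i <;> simp [sgn] <;> linarith
  sum_eq_one := by
    have : (m : ℝ) ≠ 0 := by exact_mod_cast hm.ne'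
    simp only [perturbed, ← Finset.sum_div, Finset.sum_add_distrib, Fintype.sum_prod_type,
      ← Finset.mul_sum, sum_sgn]
    simp
    field_simp

theorem isWeight_uniform {m : ℕ} (hm : 0 < m) : IsWeight (uniform m) where
  nonneg x := by unfold uniform; positivity
  sum_eq_one := by
    have : (m : ℝ) ≠ 0 := by exact_mod_cast hm.ne'
    simp [uniform]
    field_simp

/-- The second moment of the likelihood ratio of the mixture of the perturbed weights. -/
theorem sum_sum_uniform_ratio {m n : ℕ} (hm : 0 < m) {τ : ℝ} (h1 : |τ| ≤ 1) :
    ∑ σ : Fin m → Bool, ∑ σ' : Fin m → Bool,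
      (∑ x, uniform m x * ((1 + τ * (sgn (σ x.1) * sgn x.2)) *
        (1 + τ * (sgn (σ' x.1) * sgn x.2)))) ^ n ≤
      (2 ^ m) ^ 2 * Real.exp (n ^ 2 * τ ^ 4 / (2 * m)) := by
  have hm' : (0 : ℝ) < m := by exact_mod_cast hm
  -- Within a pair the terms linear in `τ` cancel, and only the correlation of `σ` and `σ'`
  -- survives.
  have key : ∀ σ σ' : Fin m → Bool, (∑ x, uniform m x * ((1 + τ * (sgn (σ x.1) * sgn x.2)) *
        (1 + τ * (sgn (σ' x.1) * sgn x.2)))) =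
      1 + τ ^ 2 / m * ∑ i, sgn (σ i) * sgn (σ' i) := by
    intro σ σ'
    have : ∀ i, ∑ b, 1 / (2 * (m : ℝ)) * ((1 + τ * (sgn (σ i) * sgn b)) *
        (1 + τ * (sgn (σ' i) * sgn b))) = 1 / m + τ ^ 2 / m * (sgn (σ i) * sgn (σ' i)) := by
      intro i
      simp [sgn]
      split_ifs <;> field_simp <;> ring
    simp only [uniform, Fintype.sum_prod_type]
    rw [Finset.sum_congr rfl fun i _ => this i, Finset.sum_add_distrib, ← Finset.mul_sum]
    simp
    field_simp
  have hnn : ∀ σ σ' : Fin m → Bool, 0 ≤ 1 + τ ^ 2 / m * ∑ i, sgn (σ i) * sgn (σ' i) := by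
    intro σ σ'
    rw [← key]
    have hb : ∀ b b' : Bool, 0 ≤ 1 + τ * (sgn b * sgn b') := by
      have := abs_le.1 h1
      intro b b'
      cases b <;> cases b' <;> simp [sgn] <;> linarith
    exact Finset.sum_nonneg fun x _ =>
      mul_nonneg ((isWeight_uniform hm).nonneg x) (mul_nonneg (hb _ _) (hb _ _))
  set t : ℝ := n * (τ ^ 2 / m) with ht
  -- The sum over `σ'` factors over the pairs; each factor is `exp t + exp (-t)`, whatever `σ i` is.
  have inner : ∀ σ : Fin m → Bool, ∑ σ' : Fin m → Bool,
      Real.exp (t * ∑ i, sgn (σ i) * sgn (σ' i)) = (2 * Real.cosh t) ^ m := by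
    intro σ
    simp only [Finset.mul_sum, Real.exp_sum]
    rw [sum_prod_eq_prod_sum (fun i b => Real.exp (t * (sgn (σ i) * sgn b)))]
    rw [Finset.prod_congr rfl (g := fun _ => 2 * Real.cosh t)]
    · simp
    · intro i _
      rw [Real.cosh_eq]
      cases σ i <;> simp [sgn] <;> ring
  calc _ ≤ ∑ σ : Fin m → Bool, ∑ σ' : Fin m → Bool,
        Real.exp (t * ∑ i, sgn (σ i) * sgn (σ' i)) := by
        refine Finset.sum_le_sum fun σ _ => Finset.sum_le_sum fun σ' _ => ?_
        rw [key]
        calc _ ≤ (Real.exp (τ ^ 2 / m * ∑ i, sgn (σ i) * sgn (σ' i))) ^ n := by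
              gcongr
              · exact hnn σ σ'
              · linarith [Real.add_one_le_exp (τ ^ 2 / m * ∑ i, sgn (σ i) * sgn (σ' i))]
          _ = _ := by rw [← Real.exp_nat_mul, ht]; ring_nf
    _ = 2 ^ m * (2 * Real.cosh t) ^ m := by simp [inner]
    _ ≤ 2 ^ m * (2 * Real.exp (t ^ 2 / 2)) ^ m := by
        have := Real.cosh_pos t
        gcongr
        exact Real.cosh_le_exp_half_sq t
    _ = _ := by
        have : (m : ℝ) * (t ^ 2 / 2) = n ^ 2 * τ ^ 4 / (2 * m) := by
          rw [ht]
          field_simp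
        rw [mul_pow, ← Real.exp_nat_mul, this]
        ring

/-- A statistic with values in `[0, 1]` that separates the uniform weights from all perturbed ones
needs many samples. -/
theorem card_sq_lower_bound {ι : Type*} [Fintype ι] [DecidableEq ι] {m : ℕ} (hm : 0 < m) {τ : ℝ}
    (hτ : |τ| ≤ 1) (f : (ι → Fin m × Bool) → ℝ) (f0 : ∀ s, 0 ≤ f s) (f1 : ∀ s, f s ≤ 1)
    (hnull : iidSum (uniform m) f ≤ 1 / 3)
    (halt : ∀ σ, 3 / 5 ≤ iidSum (perturbed m τ σ) f) :
    (m : ℝ) ≤ 32 * (Fintype.card ι) ^ 2 * τ ^ 4 := by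
  have hm' : (0 : ℝ) < m := by exact_mod_cast hm
  by_contra! hlt
  set n := Fintype.card ι
  have hu := isWeight_uniform hm
  set ℓ : (Fin m → Bool) → (ι → Fin m × Bool) → ℝ :=
    fun σ s => ∏ i, (1 + τ * (sgn (σ (s i).1) * sgn (s i).2)) with hℓ
  set L : (ι → Fin m × Bool) → ℝ := fun s => (∑ σ, ℓ σ s) / 2 ^ m with hL
  have hpert : ∀ (σ) (g : (ι → Fin m × Bool) → ℝ),
      iidSum (perturbed m τ σ) g = iidSum (uniform m) (fun s => ℓ σ s * g s) := by
    intro σ g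
    refine Finset.sum_congr rfl fun s _ => ?_
    rw [← mul_assoc, hℓ]
    dsimp only
    rw [← Finset.prod_mul_distrib]
    congr 1
    refine Finset.prod_congr rfl fun i _ => ?_
    rw [perturbed, uniform]
    ring
  have hsum1 : ∀ σ, iidSum (ι := ι) (uniform m) (ℓ σ) = 1 := by
    intro σ
    have hp : IsWeight (fun s : ι → Fin m × Bool => ∏ i, perturbed m τ σ (s i)) := by
      have hs : ∑ x, perturbed m τ σ x = 1 := by
        simp only [perturbed, ← Finset.sum_div, Finset.sum_add_distrib, Fintype.sum_prod_type,
          ← Finset.mul_sum, sum_sgn]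
        simp
        field_simp
      refine IsWeight.iid ⟨fun x => ?_, hs⟩
      have := abs_le.1 hτ
      refine div_nonneg ?_ (by positivity)
      rcases x with ⟨i, b⟩
      dsimp only
      cases b <;> cases σ i <;> simp [sgn] <;> linarith
    have := hpert σ (fun _ => 1)
    simp only [mul_one] at this
    rw [← this, iidSum]
    simpa using hp.sum_eq_one
  have hmix : iidSum (uniform m) (fun s => L s * f s) ≥ 3 / 5 := by
    have : iidSum (uniform m) (fun s => L s * f s) =
        (∑ σ, iidSum (perturbed m τ σ) f) / 2 ^ m := by
      simp only [hpert, ← iidSum_sum, hL, ← Finset.sum_mul]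
      rw [div_eq_inv_mul, ← iidSum_mul_left]
      congr 1
      ext s
      ring
    rw [this, ge_iff_le, le_div_iff₀ (by positivity)]
    calc (3 / 5 : ℝ) * 2 ^ m = ∑ σ : Fin m → Bool, (3 / 5 : ℝ) := by simp; ring
      _ ≤ _ := Finset.sum_le_sum fun σ _ => halt σ
  have hL1 : iidSum (uniform m) L = 1 := by
    simp only [hL, div_eq_inv_mul]
    rw [iidSum_mul_left, iidSum_sum]
    simp [hsum1]
  have hL2 : iidSum (uniform m) (fun s => L s ^ 2) ≤ Real.exp (n ^ 2 * τ ^ 4 / (2 * m)) := by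
    have : iidSum (uniform m) (fun s => L s ^ 2) = (∑ σ : Fin m → Bool, ∑ σ' : Fin m → Bool,
      (∑ x, uniform m x * ((1 + τ * (sgn (σ x.1) * sgn x.2)) *
        (1 + τ * (sgn (σ' x.1) * sgn x.2)))) ^ n) / (2 ^ m) ^ 2 := by
      have e : ∀ s, L s ^ 2 = ((2 ^ m) ^ 2)⁻¹ * ∑ σ, ∑ σ', ℓ σ s * ℓ σ' s := by
        intro s
        simp only [hL, div_pow, sq (∑ σ, ℓ σ s), Finset.sum_mul_sum]
        rw [div_eq_inv_mul]
      simp only [e]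
      rw [iidSum_mul_left, iidSum_sum, div_eq_inv_mul]
      congr 1
      refine Finset.sum_congr rfl fun σ _ => ?_
      rw [iidSum_sum]
      refine Finset.sum_congr rfl fun σ' _ => ?_
      have := sum_prod_eq_prod_sum (fun (_ : ι) x => uniform m x *
        ((1 + τ * (sgn (σ x.1) * sgn x.2)) * (1 + τ * (sgn (σ' x.1) * sgn x.2))))
      rw [Finset.prod_const, Finset.card_univ] at this
      rw [← this, iidSum]
      refine Finset.sum_congr rfl fun s _ => ?_
      simp only [hℓ, Finset.prod_mul_distrib]
    rw [this, div_le_iff₀ (by positivity), mul_comm]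
    exact sum_sum_uniform_ratio hm hτ
  -- The negated conclusion makes the exponent at most `1/64`. The bound is `1 + 1/18`, chosen so
  -- that `2/18 + 1/8 < 4/15 = 3/5 - 1/3` at the end.
  have hexp : Real.exp (n ^ 2 * τ ^ 4 / (2 * m)) ≤ 1 + 1 / 16 * (8 / 9) := by
    have hx : (n : ℝ) ^ 2 * τ ^ 4 / (2 * m) ≤ 1 / 64 := by
      rw [div_le_div_iff₀ (by positivity) (by norm_num)]
      linarith
    have h2 := Real.exp_bound_div_one_sub_of_interval (x := 1 / 64) (by norm_num) (by norm_num)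
    calc _ ≤ Real.exp (1 / 64) := Real.exp_le_exp.2 hx
      _ ≤ _ := h2
      _ ≤ _ := by norm_num
  have hdiff : 4 / 15 ≤ iidSum (uniform m) (fun s => (L s - 1) * f s) := by
    have : iidSum (uniform m) (fun s => L s * f s) =
      iidSum (uniform m) (fun s => (L s - 1) * f s) + iidSum (uniform m) f := by
      rw [← iidSum_add]; congr 1; ext s; ring
    linarith
  have hchi : iidSum (uniform m) (fun s => (L s - 1) ^ 2) ≤ 1 / 18 := by
    have : iidSum (uniform m) (fun s => L s ^ 2) =
      iidSum (uniform m) (fun s => (L s - 1) ^ 2) + (2 * iidSum (uniform m) L + -1) := by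
      rw [← iidSum_const (ι := ι) hu (-1), ← iidSum_mul_left, ← iidSum_add, ← iidSum_add]
      congr 1; ext s; ring
    rw [hL1] at this
    linarith
  -- the pointwise inequality `x f ≤ x² + 1/4 · f²` replaces Cauchy--Schwarz
  have hpt : iidSum (uniform m) (fun s => (L s - 1) * f s) ≤
      iidSum (uniform m) (fun s => 2 * (L s - 1) ^ 2 + 1 / 8) := by
    refine iidSum_mono hu fun s => ?_
    -- With `x = L s - 1`, the square gives `x f ≤ 2 x² + f²/8`, and `f² ≤ 1`.
    nlinarith [sq_nonneg (4 * (L s - 1) - f s), f0 s, f1 s]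
  rw [iidSum_add, iidSum_mul_left, iidSum_const hu] at hpt
  linarith

/-! ### Finitely supported laws. -/

/-- The law of `φ y` when `y` is drawn from the weights `w`. -/
noncomputable def law {V Y : Type*} [MeasurableSpace V] [Fintype Y] (w : Y → ℝ) (φ : Y → V) :
    Measure V :=
  ∑ y, ENNReal.ofReal (w y) • Measure.dirac (φ y)

section law

variable {V Y ι : Type*} [MeasurableSpace V] [Fintype Y] [Fintype ι] [DecidableEq ι] {w : Y → ℝ}
  {φ : Y → V}

theorem isProbabilityMeasure_law (hw : IsWeight w) : IsProbabilityMeasure (law w φ) := by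
  constructor
  simp only [law, Measure.coe_finsetSum, Finset.sum_apply, Measure.smul_apply, measure_univ,
    smul_eq_mul, mul_one]
  rw [← ENNReal.ofReal_sum_of_nonneg fun y _ => hw.nonneg y, hw.sum_eq_one, ENNReal.ofReal_one]

theorem lintegral_law [MeasurableSingletonClass V] (f : V → ENNReal) :
    ∫⁻ x, f x ∂(law w φ) = ∑ y, ENNReal.ofReal (w y) * f (φ y) := by
  simp [law, lintegral_smul_measure]

theorem law_apply [MeasurableSingletonClass V] (s : Set V) :
    law w φ s = ∑ y, ENNReal.ofReal (w y) * s.indicator 1 (φ y) := by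
  simp [law]

theorem pi_law [MeasurableSingletonClass V] (hw : IsWeight w) :
    Measure.pi (fun _ : ι => law w φ) =
      law (fun s : ι → Y => ∏ i, w (s i)) (fun s => φ ∘ s) := by
  have := isProbabilityMeasure_law (φ := φ) hw
  refine Measure.pi_eq fun B _ => ?_
  simp only [law_apply]
  rw [Finset.prod_univ_sum, Fintype.piFinset_univ]
  refine Finset.sum_congr rfl fun s _ => ?_
  rw [ENNReal.ofReal_prod_of_nonneg fun i _ => hw.nonneg _, Finset.prod_mul_distrib]
  congr 1
  by_cases h : φ ∘ s ∈ Set.univ.pi B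
  · rw [Set.indicator_of_mem h, Pi.one_apply, Finset.prod_eq_one]
    intro i _
    exact Set.indicator_of_mem (h i trivial) _
  · rw [Set.indicator_of_notMem h]
    simp only [Set.mem_pi, Set.mem_univ, forall_true_left, not_forall] at h
    obtain ⟨i, hi⟩ := h
    exact (Finset.prod_eq_zero (Finset.mem_univ i) (Set.indicator_of_notMem hi _)).symm

theorem freq_law [MeasurableSingletonClass V] {k : ℕ} (hw : IsWeight w) (g : Hypergraph V k) :
    g.freq (law w φ) = iidSum w (fun u : Fin k → Y => g.edges.indicator 1 (φ ∘ u)) := by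
  rw [Hypergraph.freq, pi_law hw, Measure.real, law_apply, ENNReal.toReal_sum]
  · refine Finset.sum_congr rfl fun s _ => ?_
    rw [ENNReal.toReal_mul, ENNReal.toReal_ofReal (hw.iid.nonneg s)]
    by_cases h : φ ∘ s ∈ g.edges <;> simp [h]
  · intro s _
    by_cases h : φ ∘ s ∈ g.edges <;> simp [h]

theorem freq_mem_Icc {k : ℕ} (P : Measure V) [IsProbabilityMeasure P] (g : Hypergraph V k) :
    g.freq P ∈ Set.Icc 0 1 :=
  ⟨measureReal_nonneg, measureReal_le_one⟩

theorem abs_freq_sub_freq_le {k : ℕ} (P Q : Measure V) [IsProbabilityMeasure P]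
    [IsProbabilityMeasure Q] (g : Hypergraph V k) : |g.freq P - g.freq Q| ≤ 1 := by
  have h1 := freq_mem_Icc P g
  have h2 := freq_mem_Icc Q g
  rw [abs_le]
  constructor <;> linarith [h1.1, h1.2, h2.1, h2.2]

theorem abs_freq_sub_freq_le_ipm {k : ℕ} {𝒢 : Set (Hypergraph V k)} (P Q : Measure V)
    [IsProbabilityMeasure P] [IsProbabilityMeasure Q] {g : Hypergraph V k} (hg : g ∈ 𝒢) :
    |g.freq P - g.freq Q| ≤ ipm 𝒢 P Q :=
  le_ciSup (f := fun g : 𝒢 => |g.1.freq P - g.1.freq Q|)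
    ⟨1, by rintro _ ⟨g, rfl⟩; exact abs_freq_sub_freq_le P Q g.1⟩ ⟨g, hg⟩

/-- Finite support turns the integral over samples into a finite sum, so `A` need not depend
measurably on its samples. -/
theorem prob_law [MeasurableSingletonClass V] {Z : Type*} [Fintype Z]
    {w' : Z → ℝ} {φ' : Z → V} {n₁ n₂ : ℕ} {Out : Type*} [MeasurableSpace Out]
    (A : Algorithm V n₁ n₂ Out) (hw : IsWeight w) (hw' : IsWeight w') (E : Set Out) :
    A.prob (law w φ) (law w' φ') E = ENNReal.ofReal (iidSum w' fun s₂ => iidSum w fun s₁ =>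
      (A (φ ∘ s₁) (φ' ∘ s₂) : Measure Out).real E) := by
  have hp : (Measure.pi (fun _ : Fin n₁ => law w φ)).prod (Measure.pi (fun _ : Fin n₂ => law w' φ'))
      = law (fun s : (Fin n₁ → Y) × (Fin n₂ → Z) => (∏ i, w (s.1 i)) * ∏ i, w' (s.2 i))
        (fun s => (φ ∘ s.1, φ' ∘ s.2)) := by
    rw [pi_law hw, pi_law hw']
    have := isProbabilityMeasure_law (φ := fun s : Fin n₁ → Y => φ ∘ s) hw.iid
    have := isProbabilityMeasure_law (φ := fun s : Fin n₂ → Z => φ' ∘ s) hw'.iid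
    refine Measure.prod_eq fun s t _ _ => ?_
    simp only [law_apply, Finset.sum_mul_sum, Fintype.sum_prod_type]
    refine Finset.sum_congr rfl fun a _ => Finset.sum_congr rfl fun b _ => ?_
    rw [ENNReal.ofReal_mul (hw.iid.nonneg a), mul_mul_mul_comm]
    congr 1
    by_cases h1 : φ ∘ a ∈ s <;> by_cases h2 : φ' ∘ b ∈ t <;> simp [h1, h2]
  rw [Algorithm.prob, hp, lintegral_law, iidSum_comm]
  simp only [iidSum, Finset.mul_sum]
  rw [Fintype.sum_prod_type, ENNReal.ofReal_sum_of_nonneg]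
  · refine Finset.sum_congr rfl fun a _ => ?_
    rw [ENNReal.ofReal_sum_of_nonneg]
    · refine Finset.sum_congr rfl fun b _ => ?_
      rw [← mul_assoc, ENNReal.ofReal_mul (mul_nonneg (hw.iid.nonneg a) (hw'.iid.nonneg b)),
        ofReal_measureReal]
    · exact fun b _ => mul_nonneg (hw.iid.nonneg a)
        (mul_nonneg (hw'.iid.nonneg b) measureReal_nonneg)
  · exact fun a _ => Finset.sum_nonneg fun b _ => mul_nonneg (hw.iid.nonneg a)
        (mul_nonneg (hw'.iid.nonneg b) measureReal_nonneg)

end law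

/-! ### Polarization and mixtures with fixed vertices. -/

/-- Polarization: inclusion-exclusion isolates the bijections among all maps `Fin n → Fin n`. -/
theorem sum_signed_restricted_eq_sum_perm {n : ℕ} (D : (Fin n → Fin n) → ℝ) :
    ∑ A : Finset (Fin n), (-1) ^ (Aᶜ.card) * ∑ c : Fin n → Fin n,
      (if ∀ j, c j ∈ A then D c else 0) = ∑ π : Equiv.Perm (Fin n), D π := by
  have hc : ∀ c : Fin n → Fin n, ∑ A : Finset (Fin n), (-1 : ℝ) ^ (Aᶜ.card) *
      (if ∀ j, c j ∈ A then D c else 0) = if Function.Bijective c then D c else 0 := by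
    intro c
    have hA : ∀ A : Finset (Fin n), (-1 : ℝ) ^ (Aᶜ.card) * (if ∀ j, c j ∈ A then D c else 0) =
        (∏ i ∈ Finset.univ \ A, if i ∈ Set.range c then (0 : ℝ) else -1) * D c := by
      intro A
      by_cases h : ∀ j, c j ∈ A
      · rw [← Finset.compl_eq_univ_sdiff, if_pos h, Finset.prod_congr rfl (g := fun _ => (-1 : ℝ)), Finset.prod_const]
        rintro i hi
        rw [if_neg]
        rintro ⟨j, rfl⟩
        exact Finset.mem_compl.1 hi (h j)
      · rw [if_neg h, mul_zero]
        push Not at h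
        obtain ⟨j, hj⟩ := h
        rw [Finset.prod_eq_zero (M₀ := ℝ) (i := c j) (by simpa using hj)
          (if_pos (Set.mem_range_self j)), zero_mul]
    -- For fixed `c` the signed sum over `A` is the expansion of a product over `i`, whose factor is
    -- `1` if `c` hits `i` and `1 - 1 = 0` if it misses `i`.
    have hp := Finset.prod_add (fun _ : Fin n => (1 : ℝ))
      (fun i => if i ∈ Set.range c then (0 : ℝ) else -1) Finset.univ
    simp only [Finset.prod_const_one, one_mul, Finset.powerset_univ] at hp
    rw [Finset.sum_congr rfl fun A _ => hA A, ← Finset.sum_mul, ← hp]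
    by_cases h : Function.Bijective c
    · rw [if_pos h, Finset.prod_eq_one, one_mul]
      intro i _
      rw [if_pos (show i ∈ Set.range c from h.2 i), add_zero]
    · rw [if_neg h]
      have h' : ¬ Function.Surjective c := fun hs => h ⟨Finite.injective_iff_surjective.2 hs, hs⟩
      simp only [Function.Surjective, not_forall] at h'
      obtain ⟨i, hi⟩ := h'
      rw [Finset.prod_eq_zero (Finset.mem_univ i), zero_mul]
      rw [if_neg (show i ∉ Set.range c from hi), add_neg_cancel]
  simp only [Finset.mul_sum]
  rw [Finset.sum_comm, Finset.sum_congr rfl fun c _ => hc c, ← Finset.sum_filter]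
  refine (Finset.sum_bij (fun (π : Equiv.Perm (Fin n)) _ => (π : Fin n → Fin n)) ?_ ?_ ?_ ?_).symm
  · intro π _
    exact Finset.mem_filter.2 ⟨Finset.mem_univ _, π.bijective⟩
  · intro π _ π' _ h
    exact DFunLike.coe_injective h
  · intro c hc
    exact ⟨Equiv.ofBijective c (Finset.mem_filter.1 hc).2, Finset.mem_univ _, rfl⟩
  · intro π _
    rfl

theorem card_filter_zero_mem (k : ℕ) :
    (Finset.univ.filter (fun A : Finset (Fin (k + 1)) => 0 ∈ A)).card = 2 ^ k := by
  have : Finset.univ.filter (fun A : Finset (Fin (k + 1)) => 0 ∈ A) =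
      Finset.Icc {0} Finset.univ := by
    ext A
    simp
  rw [this, Finset.card_Icc_finset (Finset.subset_univ _)]
  simp

section mixture

variable {V X : Type*} [Fintype X] {k : ℕ}

/-- The uniform weights on the set `A`. -/
noncomputable def coin {n : ℕ} (A : Finset (Fin n)) (c : Fin n) : ℝ :=
  if c ∈ A then (A.card : ℝ)⁻¹ else 0

theorem isWeight_coin {n : ℕ} {A : Finset (Fin n)} (hA : A.Nonempty) : IsWeight (coin A) where
  nonneg c := by unfold coin; split_ifs <;> positivity
  sum_eq_one := by
    have : (A.card : ℝ) ≠ 0 := by exact_mod_cast hA.card_pos.ne'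
    simp [coin, this]

/-- The vertex selected by the outcome `c` of a coin: `φ x` for `c = 0`, and one of the fixed
vertices otherwise. -/
def node (φ : X → V) (v : Fin k → V) (y : Fin (k + 1) × X) : V :=
  (Fin.cons (φ y.2) v : Fin (k + 1) → V) y.1

/-- The weights of a coin uniform on `A` and an independent draw from `q`. -/
noncomputable def mixWeight (A : Finset (Fin (k + 1))) (q : X → ℝ) (y : Fin (k + 1) × X) : ℝ :=
  coin A y.1 * q y.2

theorem isWeight_mixWeight {A : Finset (Fin (k + 1))} (hA : A.Nonempty) {q : X → ℝ}
    (hq : IsWeight q) : IsWeight (mixWeight A q) :=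
  (isWeight_coin hA).prod hq

/-- The probability that draws from `q` complete the coin outcomes `c` to an edge. -/
noncomputable def edgeProb (φ : X → V) (v : Fin k → V) (g : Hypergraph V (k + 1)) (q : X → ℝ)
    (c : Fin (k + 1) → Fin (k + 1)) : ℝ :=
  iidSum q fun s => g.edges.indicator 1 (fun j => node φ v (c j, s j))

variable (φ : X → V) (v : Fin k → V) (g : Hypergraph V (k + 1))

/-- Every coin sequence with values in `A` has the same probability. Clearing it leaves summands
independent of `A`, as polarization requires. -/
theorem card_pow_mul_freq_mix [MeasurableSpace V] [MeasurableSingletonClass V]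
    {A : Finset (Fin (k + 1))} (hA : A.Nonempty) {q : X → ℝ} (hq : IsWeight q) :
    (A.card : ℝ) ^ (k + 1) * g.freq (law (mixWeight A q) (node φ v)) =
      ∑ c : Fin (k + 1) → Fin (k + 1), if ∀ j, c j ∈ A then edgeProb φ v g q c else 0 := by
  have hc : (A.card : ℝ) ≠ 0 := by exact_mod_cast hA.card_pos.ne'
  have e : mixWeight A q = fun y => coin A y.1 * q y.2 := rfl
  rw [freq_law (isWeight_mixWeight hA hq), e, iidSum_prod]
  change _ * iidSum (coin A) (edgeProb φ v g q) = _
  rw [iidSum, Finset.mul_sum]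
  refine Finset.sum_congr rfl fun c _ => ?_
  by_cases h : ∀ j, c j ∈ A
  · rw [if_pos h, ← mul_assoc]
    have : ∏ i, coin A (c i) = ((A.card : ℝ) ^ (k + 1))⁻¹ := by
      simp [coin, h]
    rw [this, mul_inv_cancel₀ (pow_ne_zero _ hc), one_mul]
  · rw [if_neg h]
    push Not at h
    obtain ⟨j, hj⟩ := h
    rw [Finset.prod_eq_zero (Finset.mem_univ j) (if_neg hj), zero_mul, mul_zero]

/-- Permuting the independent draws along with the coordinates changes neither their law nor
membership in the symmetric edge set. -/
theorem edgeProb_perm (q : X → ℝ) (π : Equiv.Perm (Fin (k + 1))) :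
    edgeProb φ v g q π = edgeProb φ v g q id := by
  refine Fintype.sum_equiv (Equiv.arrowCongr π (Equiv.refl X)) _ _ fun s => ?_
  congr 1
  · simp only [Equiv.arrowCongr_apply, Equiv.coe_refl, Function.comp_apply]
    exact (Equiv.prod_comp π.symm fun i => q (s i)).symm
  · have h := g.symmetric π
      (fun j => node φ v (id j, (Equiv.arrowCongr π (Equiv.refl X)) s j))
    have e : (fun j => node φ v (id j, (Equiv.arrowCongr π (Equiv.refl X)) s j)) ∘ π =
        fun j => node φ v (π j, s j) := by
      funext j
      simp
    rw [e] at h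
    beta_reduce
    by_cases h' : (fun j => node φ v (π j, s j)) ∈ g.edges
    · rw [Set.indicator_of_mem h', Set.indicator_of_mem (h.1 h')]; rfl
    · rw [Set.indicator_of_notMem h', Set.indicator_of_notMem (mt h.2 h')]

/-- Only coordinate `0` uses its draw; the other draws integrate out. -/
theorem edgeProb_id {q : X → ℝ} (hq : IsWeight q) :
    edgeProb φ v g q id =
      ∑ x, q x * g.edges.indicator 1 (Fin.cons (φ x) v : Fin (k + 1) → V) := by
  have e : edgeProb φ v g q id = ∑ x, q x * iidSum (ι := Fin k) q
      (fun _ => g.edges.indicator 1 (Fin.cons (φ x) v : Fin (k + 1) → V)) := by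
    simp only [edgeProb, iidSum, Finset.mul_sum]
    rw [← Fintype.sum_prod_type' (f := fun (x : X) (t : Fin k → X) => q x * ((∏ i, q (t i)) *
      g.edges.indicator 1 (Fin.cons (φ x) v : Fin (k + 1) → V)))]
    refine Fintype.sum_equiv (Fin.consEquiv (fun _ => X)).symm _ _ fun s => ?_
    simp only [Fin.consEquiv, Equiv.coe_fn_symm_mk, Fin.prod_univ_succ, Fin.tail, ← mul_assoc]
    congr 2
    funext j
    refine Fin.cases ?_ (fun i => ?_) j <;> simp [node]
  rw [e]
  simp only [iidSum_const hq]

/-- Without the outcome `0` no draw is used. This removes all `A` not containing `0` from the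
polarization sum. -/
theorem edgeProb_eq_of_forall_ne_zero {q q' : X → ℝ} (hq : IsWeight q) (hq' : IsWeight q')
    (c : Fin (k + 1) → Fin (k + 1)) (hc : ∀ j, c j ≠ 0) :
    edgeProb φ v g q c = edgeProb φ v g q' c := by
  have e : ∀ s : Fin (k + 1) → X, (fun j => node φ v (c j, s j)) =
      fun j => v ((c j).pred (hc j)) := by
    intro s
    funext j
    obtain ⟨i, hi⟩ := Fin.exists_succ_eq.2 (hc j)
    simp only [node, ← hi]
    simp
  simp only [edgeProb, e, iidSum_const hq, iidSum_const hq']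

/-- If `q` and `q'` are told apart by the edges through the fixed vertices `v`, then some pair of their
mixtures with these vertices is told apart by `g`. -/
theorem exists_freq_mix_sub_ge [MeasurableSpace V] [MeasurableSingletonClass V] {q q' : X → ℝ}
    (hq : IsWeight q) (hq' : IsWeight q') :
    ∃ A : Finset (Fin (k + 1)), 0 ∈ A ∧
      |∑ x, (q x - q' x) * g.edges.indicator 1 (Fin.cons (φ x) v : Fin (k + 1) → V)| ≤
      2 ^ k * (k + 1) ^ (k + 1) * |g.freq (law (mixWeight A q) (node φ v)) -
        g.freq (law (mixWeight A q') (node φ v))| := by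
  set Δ : Finset (Fin (k + 1)) → ℝ := fun A => |g.freq (law (mixWeight A q) (node φ v)) -
        g.freq (law (mixWeight A q') (node φ v))| with hΔ
  set J := ∑ x, (q x - q' x) * g.edges.indicator 1 (Fin.cons (φ x) v : Fin (k + 1) → V) with hJ
  set 𝒜 : Finset (Finset (Fin (k + 1))) := Finset.univ.filter (fun A => 0 ∈ A) with h𝒜
  set D : (Fin (k + 1) → Fin (k + 1)) → ℝ :=
    fun c => edgeProb φ v g q c - edgeProb φ v g q' c with hD
  have hDid : ∀ π : Equiv.Perm (Fin (k + 1)), D π = J := by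
    intro π
    simp only [hD, edgeProb_perm, edgeProb_id φ v g hq, edgeProb_id φ v g hq', hJ, sub_mul,
      Finset.sum_sub_distrib]
  -- All permutations contribute the same `J`, so the right side becomes `(k + 1)! * J`; the
  -- factorial is later bounded below by `1`.
  have hpol := sum_signed_restricted_eq_sum_perm D
  simp only [hDid, Finset.sum_const, Finset.card_univ, Fintype.card_perm, Fintype.card_fin,
    nsmul_eq_mul] at hpol
  have hle : ∀ A : Finset (Fin (k + 1)), |(-1) ^ (Aᶜ.card) * ∑ c : Fin (k + 1) → Fin (k + 1),
      (if ∀ j, c j ∈ A then D c else 0)| ≤ if 0 ∈ A then (k + 1) ^ (k + 1) * Δ A else 0 := by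
    intro A
    rw [abs_mul, abs_pow, abs_neg, abs_one, one_pow, one_mul]
    split_ifs with hA
    · have hne : A.Nonempty := ⟨0, hA⟩
      have : ∑ c : Fin (k + 1) → Fin (k + 1), (if ∀ j, c j ∈ A then D c else 0) =
          (A.card : ℝ) ^ (k + 1) * (g.freq (law (mixWeight A q) (node φ v)) -
            g.freq (law (mixWeight A q') (node φ v))) := by
        rw [mul_sub, card_pow_mul_freq_mix φ v g hne hq, card_pow_mul_freq_mix φ v g hne hq',
          ← Finset.sum_sub_distrib]
        refine Finset.sum_congr rfl fun c _ => ?_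
        split_ifs <;> simp [hD]
      rw [this, abs_mul, abs_of_nonneg (by positivity)]
      have hcard : (A.card : ℝ) ≤ k + 1 := by
        have := Finset.card_le_univ A
        rw [Fintype.card_fin] at this
        exact_mod_cast this
      gcongr
    · rw [Finset.sum_eq_zero, abs_zero]
      intro c _
      split_ifs with h
      · rw [hD]
        dsimp only
        rw [edgeProb_eq_of_forall_ne_zero φ v g hq hq' c fun j hj => hA (hj ▸ h j), sub_self]
      · rfl
  have hne : 𝒜.Nonempty := ⟨{0}, by simp [h𝒜]⟩
  obtain ⟨A, hA, hmax⟩ := 𝒜.exists_max_image Δ hne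
  refine ⟨A, (Finset.mem_filter.1 hA).2, ?_⟩
  have hcard : 𝒜.card = 2 ^ k := by
    rw [h𝒜, card_filter_zero_mem]
  have hΔ0 : 0 ≤ Δ A := abs_nonneg _
  have hfac : (1 : ℝ) ≤ (k + 1).factorial := by exact_mod_cast Nat.factorial_pos _
  calc |J| ≤ |((k + 1).factorial : ℝ) * J| := by
        rw [abs_mul, Nat.abs_cast]
        exact le_mul_of_one_le_left (abs_nonneg _) hfac
    _ ≤ ∑ A : Finset (Fin (k + 1)), if 0 ∈ A then (k + 1) ^ (k + 1) * Δ A else 0 := by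
        rw [← hpol]
        exact (Finset.abs_sum_le_sum_abs _ _).trans (Finset.sum_le_sum fun A _ => hle A)
    _ = ∑ A ∈ 𝒜, (k + 1) ^ (k + 1) * Δ A := by rw [h𝒜, Finset.sum_filter]
    _ ≤ ∑ _B ∈ 𝒜, (k + 1) ^ (k + 1) * Δ A := by
        refine Finset.sum_le_sum fun B hB => ?_
        have := hmax B hB
        gcongr
    _ = _ := by
        rw [Finset.sum_const, hcard, nsmul_eq_mul]
        push_cast
        ring

end mixture

/-! ### Shattered sets from the graph VC dimension. -/

/-- The strict inequality supplies a witness at every supremum in the recursion, so no attainment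
has to be shown; the links chosen along the way form `v`. -/
theorem exists_shattered_of_lt_gVC {V : Type*} (k : ℕ) (𝒢 : Set (Hypergraph V (k + 1))) (r : ℕ∞)
    (h : r < gVC (k + 1) 𝒢) :
    ∃ (v : Fin k → V) (S : Finset V), r < S.card ∧ ∀ T : Set V, T ⊆ ↑S →
      ∃ g ∈ 𝒢, ∀ x ∈ S, ((Fin.cons x v : Fin (k + 1) → V) ∈ g.edges ↔ x ∈ T) := by
  induction k with
  | zero =>
    simp only [gVC, vcDim, lt_iSup_iff] at h
    obtain ⟨S, hS, hr⟩ := h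
    refine ⟨Fin.elim0, S, hr, fun T hT => ?_⟩
    obtain ⟨_, ⟨g, hg, rfl⟩, hd⟩ := hS T hT
    refine ⟨g, hg, fun x hx => ?_⟩
    have e : (Fin.cons x Fin.elim0 : Fin 1 → V) = fun _ => x := by
      funext i
      rw [Fin.fin_one_eq_zero i]
      rfl
    rw [e, ← hd]
    exact ⟨fun h => ⟨h, hx⟩, fun h => h.1⟩
  | succ k ih =>
    simp only [gVC, lt_iSup_iff] at h
    obtain ⟨v₀, hv₀⟩ := h
    obtain ⟨v, S, hr, hS⟩ := ih _ hv₀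
    refine ⟨Fin.cons v₀ v, S, hr, fun T hT => ?_⟩
    obtain ⟨_, ⟨g, hg, rfl⟩, hd⟩ := hS T hT
    refine ⟨g, hg, fun x hx => ?_⟩
    rw [← hd x hx, ← g.symmetric (Equiv.swap 0 1)]
    -- The link puts `v₀` first, while the free vertex `x` should come first; symmetry of `g` under
    -- the swap reconciles the two.
    have e : (Fin.cons x (Fin.cons v₀ v) : Fin (k + 2) → V) ∘ Equiv.swap 0 1 =
        Fin.cons v₀ (Fin.cons x v) := by
      funext i
      refine Fin.cases ?_ (fun j => Fin.cases ?_ (fun l => ?_) j) i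
      · rw [Function.comp_apply, Equiv.swap_apply_left, ← Fin.succ_zero_eq_one]
        simp
      · simp
      · have h0 : l.succ.succ ≠ (0 : Fin (k + 2)) := Fin.succ_ne_zero _
        have h1 : l.succ.succ ≠ (1 : Fin (k + 2)) := by
          rw [← Fin.succ_zero_eq_one]
          exact fun h => Fin.succ_ne_zero _ (Fin.succ_injective _ h)
        simp [Equiv.swap_apply_of_ne_of_ne h0 h1]
    rw [e]
    rfl

/-! ### Reduction of testing to the perturbed weights. -/

section reduction

variable {V : Type*} [MeasurableSpace V] {k m : ℕ}

/-- The law of a vertex that is uniform on `A`, where `0 ∈ A` stands for a vertex drawn from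
the weights `q` and the other elements of `A` stand for the fixed vertices `v`. -/
noncomputable abbrev mixLaw {X : Type*} [Fintype X] (φ : X → V) (v : Fin k → V)
    (A : Finset (Fin (k + 1))) (q : X → ℝ) : Measure V :=
  law (mixWeight A q) (node φ v)

/-- On the favoured point of each pair the perturbation adds `τ / (2m)`, in total `τ/2`, and
polarization carries this gap over to one of the mixtures. -/
theorem exists_half_le_mixLaw [MeasurableSingletonClass V] {𝒢 : Set (Hypergraph V (k + 1))}
    {φ : Fin m × Bool → V} {v : Fin k → V} (hm : 0 < m) {τ : ℝ} (h0 : 0 ≤ τ) (h1 : τ ≤ 1)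
    (σ : Fin m → Bool)
    (hsh : ∃ g ∈ 𝒢, ∀ x, ((Fin.cons (φ x) v : Fin (k + 1) → V) ∈ g.edges ↔ σ x.1 = x.2)) :
    ∃ A : Finset (Fin (k + 1)), 0 ∈ A ∧ τ / 2 ≤ 2 ^ k * (k + 1) ^ (k + 1) *
      ipm 𝒢 (mixLaw φ v A (uniform m)) (mixLaw φ v A (perturbed m τ σ)) := by
  obtain ⟨g, hg, hx⟩ := hsh
  have hu := isWeight_uniform hm
  have hp := isWeight_perturbed hm h0 h1 σ
  obtain ⟨A, hA, hJ⟩ := exists_freq_mix_sub_ge φ v g hu hp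
  refine ⟨A, hA, ?_⟩
  have := isProbabilityMeasure_law (φ := node φ v) (isWeight_mixWeight ⟨0, hA⟩ hu)
  have := isProbabilityMeasure_law (φ := node φ v) (isWeight_mixWeight ⟨0, hA⟩ hp)
  have hval : ∑ x, (uniform m x - perturbed m τ σ x) *
      g.edges.indicator 1 (Fin.cons (φ x) v : Fin (k + 1) → V) = -(τ / 2) := by
    have hm' : (m : ℝ) ≠ 0 := by exact_mod_cast hm.ne'
    have : ∀ i, ∑ b, (uniform m (i, b) - perturbed m τ σ (i, b)) *
        g.edges.indicator 1 (Fin.cons (φ (i, b)) v : Fin (k + 1) → V) = -(τ / (2 * m)) := by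
      intro i
      rw [Finset.sum_eq_single (σ i)]
      · rw [Set.indicator_of_mem ((hx _).2 rfl), uniform, perturbed, sgn_mul_self, Pi.one_apply]
        ring
      · intro b _ hb
        rw [Set.indicator_of_notMem (fun h => hb ((hx _).1 h).symm), mul_zero]
      · exact fun h => absurd (Finset.mem_univ _) h
    rw [Fintype.sum_prod_type, Finset.sum_congr rfl fun i _ => this i]
    simp
    field_simp
  rw [hval, abs_neg, abs_of_nonneg (by positivity)] at hJ
  refine hJ.trans ?_
  gcongr
  exact abs_freq_sub_freq_le_ipm _ _ hg

/-- A family of statistics that separate the mixtures of the uniform weights with the fixed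
vertices from those mixtures of perturbed weights that are far from them. -/
theorem card_sq_lower_bound_of_mixLaw [MeasurableSingletonClass V]
    {𝒢 : Set (Hypergraph V (k + 1))}
    {φ : Fin m × Bool → V} {v : Fin k → V} (hm : 0 < m) {τ : ℝ} (h0 : 0 ≤ τ) (h1 : τ ≤ 1)
    (hsh : ∀ σ : Fin m → Bool, ∃ g ∈ 𝒢, ∀ x,
      ((Fin.cons (φ x) v : Fin (k + 1) → V) ∈ g.edges ↔ σ x.1 = x.2))
    {ι : Type*} [Fintype ι] [DecidableEq ι] (d : Finset (Fin (k + 1)) → (ι → V) → ℝ)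
    (d0 : ∀ A s, 0 ≤ d A s) {a : ℝ} (ha : 2 ^ k * a ≤ 1 / 3)
    (hnull : ∀ A, 0 ∈ A → iidSum (mixWeight A (uniform m)) (fun s => d A (node φ v ∘ s)) ≤ a)
    (halt : ∀ A σ, 0 ∈ A → τ / 2 ≤ 2 ^ k * (k + 1) ^ (k + 1) *
        ipm 𝒢 (mixLaw φ v A (uniform m)) (mixLaw φ v A (perturbed m τ σ)) →
      3 / 5 ≤ iidSum (mixWeight A (perturbed m τ σ)) (fun s => d A (node φ v ∘ s)))
    (d1 : ∀ A s, d A s ≤ 1) :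
    (m : ℝ) ≤ 32 * (Fintype.card ι) ^ 2 * τ ^ 4 := by
  -- The coins do not depend on `q`, so averaging over them leaves a statistic of the draws from `q`
  -- alone.
  set F : Finset (Fin (k + 1)) → (ι → Fin m × Bool) → ℝ := fun A t =>
    iidSum (coin A) (fun c => d A (fun i => node φ v (c i, t i))) with hF
  have hFeq : ∀ A (q : Fin m × Bool → ℝ),
      iidSum (mixWeight A q) (fun s => d A (node φ v ∘ s)) = iidSum q (F A) := by
    intro A q
    have e : mixWeight A q = fun y => coin A y.1 * q y.2 := rfl
    rw [e, iidSum_prod, iidSum_comm]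
    rfl
  have F0 : ∀ A, 0 ∈ A → ∀ t, 0 ≤ F A t := fun A hA t =>
    iidSum_nonneg (isWeight_coin ⟨0, hA⟩) fun c => d0 A _
  have F1 : ∀ A, 0 ∈ A → ∀ t, F A t ≤ 1 := fun A hA t =>
    iidSum_le (isWeight_coin ⟨0, hA⟩) fun c => d1 A _
  have hu := isWeight_uniform hm
  set 𝒜 : Finset (Finset (Fin (k + 1))) := Finset.univ.filter (fun A => 0 ∈ A) with h𝒜
  refine card_sq_lower_bound hm (abs_le.2 ⟨by linarith, h1⟩)
    -- The right `A` is unknown, so all are summed: the null expectations add up to at most `2 ^ k *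
    -- a`, and one good `A` suffices for detection.
    (fun t => min 1 (∑ A ∈ 𝒜, F A t)) (fun t => ?_) (fun t => min_le_left _ _) ?_ fun σ => ?_
  · exact le_min zero_le_one (Finset.sum_nonneg fun A hA => F0 A (Finset.mem_filter.1 hA).2 t)
  · calc _ ≤ iidSum (uniform m) (fun t => ∑ A ∈ 𝒜, F A t) :=
          iidSum_mono hu fun t => min_le_right _ _
      _ = ∑ A ∈ 𝒜, iidSum (uniform m) (F A) := iidSum_sum _ _
      _ ≤ ∑ A ∈ 𝒜, a := Finset.sum_le_sum fun A hA => by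
          rw [← hFeq]
          exact hnull A (Finset.mem_filter.1 hA).2
      _ = 2 ^ k * a := by
          rw [Finset.sum_const, h𝒜, card_filter_zero_mem, nsmul_eq_mul]
          push_cast
          rfl
      _ ≤ _ := ha
  · obtain ⟨A, hA, hJ⟩ := exists_half_le_mixLaw hm h0 h1 σ (hsh σ)
    refine (halt A σ hA hJ).trans ?_
    rw [hFeq]
    refine iidSum_mono (isWeight_perturbed hm h0 h1 σ) fun t => le_min (F1 A hA t) ?_
    exact Finset.single_le_sum (f := fun A => F A t)
      (fun B hB => F0 B (Finset.mem_filter.1 hB).2 t)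
      (Finset.mem_filter.2 ⟨Finset.mem_univ _, hA⟩)

/-- The first sample comes from the known null mixture and is averaged out, so only `n₂` enters the
bound. -/
theorem card_sq_lower_bound_of_isTesting [MeasurableSingletonClass V]
    {𝒢 : Set (Hypergraph V (k + 1))}
    {φ : Fin m × Bool → V} {v : Fin k → V} (hm : 0 < m) {τ : ℝ} (h0 : 0 ≤ τ) (h1 : τ ≤ 1)
    (hsh : ∀ σ : Fin m → Bool, ∃ g ∈ 𝒢, ∀ x,
      ((Fin.cons (φ x) v : Fin (k + 1) → V) ∈ g.edges ↔ σ x.1 = x.2))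
    {n₁ n₂ : ℕ} {ε δ : ℝ} (hε : 2 ^ k * (k + 1) ^ (k + 1) * ε < τ / 2) (hδ : 2 ^ k * δ ≤ 1 / 3)
    (A : Algorithm V n₁ n₂ Verdict) (hA : IsTesting 𝒢 A ε δ) :
    (m : ℝ) ≤ 32 * n₂ ^ 2 * τ ^ 4 := by
  have hδ' : δ ≤ 1 / 3 := by
    by_contra! h
    have : (1 : ℝ) ≤ 2 ^ k := one_le_pow₀ (by norm_num)
    nlinarith
  have hu := isWeight_uniform hm
  set d : Finset (Fin (k + 1)) → (Fin n₂ → V) → ℝ := fun B s₂ =>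
    iidSum (mixWeight B (uniform m)) fun s₁ : Fin n₁ → Fin (k + 1) × Fin m × Bool =>
      -- The guard keeps the statistic in `[0, 1]` for every `B`, including the empty set, where
      -- `coin` is not a probability weight.
      if 0 ∈ B then (A (node φ v ∘ s₁) s₂ : Measure Verdict).real {Verdict.distinct} else 0
    with hd
  have := card_sq_lower_bound_of_mixLaw (ι := Fin n₂) hm h0 h1 hsh d ?_ hδ ?_ ?_ ?_
  · simpa using this
  · intro B s
    by_cases hB : 0 ∈ B
    · simp only [hd, if_pos hB]
      exact iidSum_nonneg (isWeight_mixWeight ⟨0, hB⟩ hu) fun _ => measureReal_nonneg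
    · simp [hd, hB, iidSum]
  · intro B hB
    have hw := isWeight_mixWeight ⟨0, hB⟩ hu
    have hP := isProbabilityMeasure_law (φ := node φ v) hw
    have h := (hA _ _ hP hP).1 rfl
    rw [prob_law A hw hw, ENNReal.ofReal_le_ofReal_iff] at h
    · simp only [hd, if_pos hB]
      have e : ∀ s₁ s₂, (A s₁ s₂ : Measure Verdict).real {Verdict.equivalent} +
          (A s₁ s₂ : Measure Verdict).real {Verdict.distinct} = 1 := by
        intro s₁ s₂
        rw [← measureReal_union (by simp) (MeasurableSpace.measurableSet_top)]
        have : ({Verdict.equivalent} ∪ {Verdict.distinct} : Set Verdict) = Set.univ := by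
          ext x
          cases x <;> simp
        rw [this]
        exact probReal_univ
      have e' : iidSum (mixWeight B (uniform m)) (fun s₂ : Fin n₂ → _ =>
            iidSum (mixWeight B (uniform m)) fun s₁ : Fin n₁ → _ =>
            (A (node φ v ∘ s₁) (node φ v ∘ s₂) : Measure Verdict).real {Verdict.equivalent}) +
          iidSum (mixWeight B (uniform m)) (fun s₂ : Fin n₂ → _ =>
            iidSum (mixWeight B (uniform m)) fun s₁ : Fin n₁ → _ =>
            (A (node φ v ∘ s₁) (node φ v ∘ s₂) : Measure Verdict).real {Verdict.distinct}) = 1 := by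
        simp only [← iidSum_add, e, iidSum_const hw]
      linarith
    · exact iidSum_nonneg hw fun _ => iidSum_nonneg hw fun _ => measureReal_nonneg
  · intro B σ hB hI
    have hw := isWeight_mixWeight ⟨0, hB⟩ hu
    have hw' := isWeight_mixWeight ⟨0, hB⟩ (isWeight_perturbed hm h0 h1 σ)
    have hP := isProbabilityMeasure_law (φ := node φ v) hw
    have hP' := isProbabilityMeasure_law (φ := node φ v) hw'
    have h := (hA _ _ hP hP').2 (lt_of_mul_lt_mul_left (hε.trans_le hI) (by positivity))
    rw [prob_law A hw hw', ENNReal.ofReal_le_ofReal_iff] at h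
    · simp only [hd, if_pos hB]
      linarith
    · exact iidSum_nonneg hw' fun _ => iidSum_nonneg hw fun _ => measureReal_nonneg
  · intro B s
    by_cases hB : 0 ∈ B
    · simp only [hd, if_pos hB]
      exact iidSum_le (isWeight_mixWeight ⟨0, hB⟩ hu) fun _ => measureReal_le_one
    · simp [hd, hB, iidSum]

/-! ### From discriminating algorithms to tests. -/

/-- The fraction of the given `k`-tuples that are edges of `g`. -/
noncomputable def edgeMean {V : Type*} {k M : ℕ} (t : Fin M → Fin k → V) (g : Hypergraph V k) : ℝ :=
  (∑ j, g.edges.indicator 1 (t j)) / M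

theorem measurable_indicator_edges {V : Type*} {k : ℕ} (u : Fin k → V) :
    Measurable (fun g : Hypergraph V k => g.edges.indicator (1 : (Fin k → V) → ℝ) u) := by
  have : (fun g : Hypergraph V k => g.edges.indicator (1 : (Fin k → V) → ℝ) u) =
      {g : Hypergraph V k | u ∈ g.edges}.indicator 1 := by
    funext g
    by_cases h : u ∈ g.edges <;> simp [h]
  rw [this]
  exact measurable_one.indicator (MeasurableSpace.measurableSet_generateFrom ⟨u, rfl⟩)

theorem measurable_edgeMean {V : Type*} {k M : ℕ} (t : Fin M → Fin k → V) :
    Measurable (edgeMean t) :=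
  (Finset.measurable_sum _ fun _ _ => measurable_indicator_edges _).div_const _

/-- For a finitely supported law the frequency is a finite combination of edge indicators, which
generate the `σ`-algebra. -/
theorem measurable_freq_law [MeasurableSingletonClass V] {Y : Type*} [Fintype Y] {w : Y → ℝ}
    (hw : IsWeight w) (φ : Y → V) :
    Measurable (fun g : Hypergraph V k => g.freq (law w φ)) := by
  simp only [freq_law hw, iidSum]
  exact Finset.measurable_sum _ fun _ _ => (measurable_indicator_edges _).const_mul _

/-- The tuples are independent of the random `g`, so exchanging the expectations leaves Chebyshev
for a single fixed `g`; no uniform bound over `𝒢` is needed. -/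
theorem iidSum_measure_deviation_le [MeasurableSingletonClass V] {Y : Type*} [Fintype Y]
    {w : Y → ℝ} (hw : IsWeight w) (φ : Y → V) {𝒢 : Set (Hypergraph V k)} (μ : Measure 𝒢)
    [IsProbabilityMeasure μ] {M : ℕ} (hM : 0 < M) {ε : ℝ} (hε : 0 < ε) :
    iidSum (fun s : Fin k → Y => ∏ i, w (s i)) (fun t : Fin M → Fin k → Y =>
      μ.real {g | ε < |edgeMean (fun j => φ ∘ t j) g.1 - g.1.freq (law w φ)|}) ≤
      1 / (M * ε ^ 2) := by
  have hmeas : ∀ t : Fin M → Fin k → Y, MeasurableSet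
      {g : 𝒢 | ε < |edgeMean (fun j => φ ∘ t j) g.1 - g.1.freq (law w φ)|} := by
    intro t
    refine measurableSet_lt measurable_const ?_
    have h1 := (measurable_edgeMean (fun j => φ ∘ t j)).comp (measurable_subtype_coe (p := (· ∈ 𝒢)))
    have h2 := (measurable_freq_law (k := k) hw φ).comp (measurable_subtype_coe (p := (· ∈ 𝒢)))
    exact continuous_abs.measurable.comp (h1.sub h2)
  have hint : ∀ t : Fin M → Fin k → Y, Integrable
      ({g : 𝒢 | ε < |edgeMean (fun j => φ ∘ t j) g.1 - g.1.freq (law w φ)|}.indicator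
        (1 : 𝒢 → ℝ)) μ := fun t =>
    (integrable_const (1 : ℝ)).indicator (hmeas t)
  calc _ = ∫ g, iidSum (fun s : Fin k → Y => ∏ i, w (s i)) (fun t : Fin M → Fin k → Y =>
        {g : 𝒢 | ε < |edgeMean (fun j => φ ∘ t j) g.1 - g.1.freq (law w φ)|}.indicator
          (1 : 𝒢 → ℝ) g) ∂μ := by
        simp only [iidSum]
        rw [integral_finsetSum _ fun t _ => (hint t).const_mul _]
        refine Finset.sum_congr rfl fun t _ => ?_
        rw [integral_const_mul, integral_indicator_one (hmeas t)]
    _ ≤ ∫ _, 1 / (M * ε ^ 2) ∂μ := by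
        refine integral_mono ?_ (integrable_const _) fun g => ?_
        · exact integrable_finsetSum _ fun t _ => (hint t).const_mul _
        · have h := iidSum_deviation_le (hw.iid (ι := Fin k))
            (fun s => g.1.edges.indicator 1 (φ ∘ s))
            (fun s => Set.indicator_nonneg (fun _ _ => zero_le_one) _)
            (fun s => Set.indicator_le_self' (f := 1) (fun _ _ => zero_le_one) _) hM hε
          refine le_of_eq_of_le ?_ h
          refine Finset.sum_congr rfl fun t _ => ?_
          have hf : g.1.freq (law w φ) =
              ∑ s : Fin k → Y, (∏ i, w (s i)) * g.1.edges.indicator 1 (φ ∘ s) := freq_law hw g.1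
          rw [← hf]
          rfl
    _ = _ := by simp

/-- The test runs `A`, estimates the frequency of its output on `M` fresh tuples from the second
law, and rejects if the estimate is more than `ε` away from the known null frequency. A far
alternative is rejected with probability at least `1 - 1/3 - 1/15 = 3/5`. -/
theorem card_sq_lower_bound_of_isDiscriminating [MeasurableSingletonClass V]
    {𝒢 : Set (Hypergraph V (k + 1))}
    {φ : Fin m × Bool → V} {v : Fin k → V} (hm : 0 < m) {τ : ℝ} (h0 : 0 ≤ τ) (h1 : τ ≤ 1)
    (hsh : ∀ σ : Fin m → Bool, ∃ g ∈ 𝒢, ∀ x,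
      ((Fin.cons (φ x) v : Fin (k + 1) → V) ∈ g.edges ↔ σ x.1 = x.2))
    {n₁ n₂ M : ℕ} {ε δ : ℝ} (hε0 : 0 < ε) (hε : 2 ^ k * (k + 1) ^ (k + 1) * (3 * ε) ≤ τ / 2)
    (hδ : δ ≤ 1 / 3) (hM0 : 0 < M) (hM : 2 ^ k * (1 / (M * ε ^ 2)) ≤ 1 / 15)
    (A : Algorithm V n₁ n₂ 𝒢) (hA : IsDiscriminating 𝒢 A ε δ) :
    (m : ℝ) ≤ 32 * (n₂ + M * (k + 1)) ^ 2 * τ ^ 4 := by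
  have hη : 1 / (M * ε ^ 2) ≤ 1 / 15 :=
    le_trans (le_mul_of_one_le_left (by positivity) (one_le_pow₀ (by norm_num))) hM
  have hu := isWeight_uniform hm
  set Ev : Finset (Fin (k + 1)) → (Fin M → Fin (k + 1) → V) → Set 𝒢 := fun B t =>
    {g | ε < |edgeMean t g.1 - g.1.freq (mixLaw φ v B (uniform m))|} with hEv
  set d : Finset (Fin (k + 1)) → (Fin n₂ ⊕ Fin M × Fin (k + 1) → V) → ℝ := fun B s =>
    iidSum (mixWeight B (uniform m)) fun s₁ : Fin n₁ → Fin (k + 1) × Fin m × Bool =>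
      if 0 ∈ B then (A (node φ v ∘ s₁) (s ∘ Sum.inl) : Measure 𝒢).real
        (Ev B fun j i => s (Sum.inr (j, i))) else 0
    with hd
  have hdsum : ∀ B, 0 ∈ B → ∀ q : Fin m × Bool → ℝ,
      iidSum (mixWeight B q) (fun s => d B (node φ v ∘ s)) =
      iidSum (mixWeight B q) fun s₂ => iidSum (mixWeight B (uniform m)) fun s₁ =>
        iidSum (fun s : Fin (k + 1) → _ => ∏ i, mixWeight B q (s i))
          fun t : Fin M → Fin (k + 1) → _ =>
          (A (node φ v ∘ s₁) (node φ v ∘ s₂) : Measure 𝒢).real (Ev B fun j => node φ v ∘ t j) := by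
    intro B hB q
    rw [iidSum_sumType]
    congr 1
    funext s₂
    rw [iidSum_curry, iidSum_comm]
    simp only [if_pos hB]
    rfl
  have := card_sq_lower_bound_of_mixLaw (ι := Fin n₂ ⊕ Fin M × Fin (k + 1)) hm h0 h1 hsh d ?_
    (hM.trans (by norm_num)) ?_ ?_ ?_
  · simpa using this
  · intro B s
    by_cases hB : 0 ∈ B
    · simp only [hd, if_pos hB]
      exact iidSum_nonneg (isWeight_mixWeight ⟨0, hB⟩ hu) fun _ => measureReal_nonneg
    · simp [hd, hB, iidSum]
  · intro B hB
    have hw := isWeight_mixWeight ⟨0, hB⟩ hu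
    rw [hdsum B hB]
    exact iidSum_le hw fun s₂ => iidSum_le hw fun s₁ =>
      iidSum_measure_deviation_le hw (node φ v) _ hM0 hε0
  · intro B σ hB hI
    have hw := isWeight_mixWeight ⟨0, hB⟩ hu
    have hw' := isWeight_mixWeight ⟨0, hB⟩ (isWeight_perturbed hm h0 h1 σ)
    have hP := isProbabilityMeasure_law (φ := node φ v) hw
    have hP' := isProbabilityMeasure_law (φ := node φ v) hw'
    have hipm : 3 * ε ≤ ipm 𝒢 (mixLaw φ v B (uniform m)) (mixLaw φ v B (perturbed m τ σ)) :=
      le_of_mul_le_mul_left (hε.trans hI) (by positivity)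
    have h := hA _ _ hP hP'
    rw [prob_law A hw hw', ENNReal.ofReal_le_ofReal_iff] at h
    · rw [hdsum B hB]
      have hkey : ∀ s₂ : Fin n₂ → Fin (k + 1) × Fin m × Bool,
          ∀ s₁ : Fin n₁ → Fin (k + 1) × Fin m × Bool,
          (A (node φ v ∘ s₁) (node φ v ∘ s₂) : Measure 𝒢).real
            {g | |g.1.freq (mixLaw φ v B (uniform m)) -
              g.1.freq (mixLaw φ v B (perturbed m τ σ))| >
              ipm 𝒢 (mixLaw φ v B (uniform m)) (mixLaw φ v B (perturbed m τ σ)) - ε} ≤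
          iidSum (fun s : Fin (k + 1) → _ => ∏ i, mixWeight B (perturbed m τ σ) (s i))
            (fun t : Fin M → Fin (k + 1) → _ =>
            (A (node φ v ∘ s₁) (node φ v ∘ s₂) : Measure 𝒢).real
              (Ev B fun j => node φ v ∘ t j)) + 1 / 15 := by
        intro s₂ s₁
        refine le_trans ?_ (add_le_add_right ((iidSum_measure_deviation_le hw' (node φ v)
          (A (node φ v ∘ s₁) (node φ v ∘ s₂) : Measure 𝒢) hM0 hε0).trans hη) _)
        rw [← iidSum_add]
        refine le_iidSum hw'.iid fun t => (measureReal_mono ?_).trans (measureReal_union_le _ _)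
        intro g hg
        simp only [Set.mem_ofPred_eq, gt_iff_lt] at hg
        simp only [hEv, Set.mem_union, Set.mem_ofPred_eq]
        -- If the estimate were within `ε` of both frequencies, these would differ by at most `2ε`,
        -- whereas a successful output has a gap above `ipm - ε ≥ 2ε`.
        by_contra! hcon
        have := abs_sub_le (g.1.freq (mixLaw φ v B (uniform m)))
          (edgeMean (fun j => node φ v ∘ t j) g.1) (g.1.freq (mixLaw φ v B (perturbed m τ σ)))
        rw [abs_sub_comm (g.1.freq (mixLaw φ v B (uniform m))) (edgeMean _ _)] at this
        linarith [hcon.1, hcon.2]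
      have h' := h.trans (iidSum_mono hw' fun s₂ => iidSum_mono hw fun s₁ => hkey s₂ s₁)
      simp only [iidSum_add, iidSum_const hw, iidSum_const hw'] at h'
      linarith
    · exact iidSum_nonneg hw' fun _ => iidSum_nonneg hw fun _ => measureReal_nonneg
  · intro B s
    by_cases hB : 0 ∈ B
    · simp only [hd, if_pos hB]
      exact iidSum_le (isWeight_mixWeight ⟨0, hB⟩ hu) fun _ => measureReal_le_one
    · simp [hd, hB, iidSum]

end reduction

/-! ### Pairing of the shattered set and choice of constants. -/

theorem exists_embedded_cube_of_gVC {V : Type*} {k : ℕ} {𝒢 : Set (Hypergraph V (k + 1))} {ρ : ℕ}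
    (hρ : gVC (k + 1) 𝒢 = ρ) (h2 : 2 ≤ ρ) :
    ∃ (m : ℕ) (φ : Fin m × Bool → V) (v : Fin k → V), 0 < m ∧ ρ ≤ 3 * m ∧
      ∀ σ : Fin m → Bool, ∃ g ∈ 𝒢, ∀ x,
        ((Fin.cons (φ x) v : Fin (k + 1) → V) ∈ g.edges ↔ σ x.1 = x.2) := by
  obtain ⟨v, S, hS, hT⟩ := exists_shattered_of_lt_gVC k 𝒢 ((ρ - 1 : ℕ) : ℕ∞) (by
    rw [hρ]
    exact_mod_cast (by omega : ρ - 1 < ρ))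
  have hS' : ρ - 1 < S.card := by exact_mod_cast hS
  obtain ⟨e⟩ := Function.Embedding.nonempty_of_card_le (α := Fin (ρ / 2) × Bool) (β := S) (by
    simp only [Fintype.card_prod, Fintype.card_fin, Fintype.card_bool, Fintype.card_coe]
    omega)
  -- Since `ρ ≥ 2`, integer division gives `ρ ≤ 2 (ρ / 2) + 1 ≤ 3 (ρ / 2)`.
  refine ⟨ρ / 2, fun x => e x, v, by omega, by omega, fun σ => ?_⟩
  obtain ⟨g, hg, hx⟩ := hT ((fun x => (e x : V)) '' {x | σ x.1 = x.2}) (by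
    rintro _ ⟨x, _, rfl⟩
    exact (e x).2)
  refine ⟨g, hg, fun x => ?_⟩
  rw [hx _ (e x).2]
  constructor
  · rintro ⟨y, hy, hyx⟩
    rw [← e.injective (Subtype.ext hyx)]
    exact hy
  · exact fun h => ⟨x, h, rfl⟩

theorem two_rpow_neg_mul_logb (k : ℕ) :
    (2 : ℝ) ^ (-(((k + 1 : ℕ) : ℝ) * Real.logb 2 ((k + 1 : ℕ) : ℝ))) =
      (((k : ℝ) + 1) ^ (k + 1))⁻¹ := by
  rw [Real.rpow_neg (by norm_num), mul_comm, Real.rpow_mul (by norm_num),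
    Real.rpow_logb (by norm_num) (by norm_num) (by positivity), Real.rpow_natCast]
  push_cast
  rfl

theorem two_pow_mul_succ_pow_le (k : ℕ) :
    2 * (2 ^ k * ((k : ℝ) + 1) ^ (k + 1)) ≤ 2 ^ ((k + 1) ^ 2) := by
  have h : (k : ℝ) + 1 ≤ 2 ^ k := by exact_mod_cast Nat.lt_two_pow_self (n := k)
  calc 2 * (2 ^ k * ((k : ℝ) + 1) ^ (k + 1)) ≤ 2 * (2 ^ k * (2 ^ k) ^ (k + 1)) := by gcongr
    _ = _ := by ring

/-- Lets the failure probability `k^(-k) / 3` of the theorem pay for the sum over `2^(k-1)` sets. -/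
theorem two_pow_le_succ_pow (k : ℕ) : (2 : ℝ) ^ k ≤ ((k : ℝ) + 1) ^ (k + 1) := by
  rcases Nat.eq_zero_or_pos k with rfl | hk
  · simp
  · have h : (2 : ℝ) ≤ k + 1 := by exact_mod_cast Nat.succ_le_succ hk
    calc (2 : ℝ) ^ k ≤ 2 ^ (k + 1) := pow_le_pow_right₀ (by norm_num) (by omega)
      _ ≤ _ := by gcongr

theorem sq_le_cube_of_pos {k : ℕ} (hk : 1 ≤ k) : k ≤ k ^ 3 ∧ k ^ 2 ≤ k ^ 3 ∧ 1 ≤ k ^ 3 :=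
  ⟨Nat.le_self_pow (by norm_num) k, Nat.pow_le_pow_right hk (by norm_num), Nat.one_le_pow _ _ hk⟩

theorem sqrt_le_of_le_sq {m ρ : ℕ} {N τ : ℝ} (hN : 0 ≤ N) (hρ : ρ ≤ 3 * m)
    (h : (m : ℝ) ≤ 32 * N ^ 2 * τ ^ 4) : √(ρ : ℝ) ≤ 10 * N * τ ^ 2 := by
  refine Real.sqrt_le_iff.2 ⟨by positivity, ?_⟩
  have : (ρ : ℝ) ≤ 3 * m := by exact_mod_cast hρ
  have h0 : 0 ≤ N ^ 2 * τ ^ 4 := by positivity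
  -- The constant works because `3 * 32 = 96 ≤ 10 ^ 2`.
  nlinarith

end GraphDisc

theorem mainTheorem2 :
    ∃ (c : ℝ) (a : ℕ), 0 < c ∧
      ∀ (V : Type*) [Countable V] [MeasurableSpace V] [DiscreteMeasurableSpace V]
        (k : ℕ), 1 ≤ k → ∀ (𝒢 : Set (GraphDisc.Hypergraph V k)) (ρ : ℕ),
        GraphDisc.gVC k 𝒢 = (ρ : ℕ∞) →
        ∀ ε : ℝ, 0 < ε → ε ≤ 1 / 2 ^ (3 * k ^ 3) → ∀ n₁ n₂ : ℕ,
          -- discriminating algorithms, for large `ρ`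
          ((2 : ℝ) ^ (a * k ^ 3) ≤ ρ →
            ∀ A : GraphDisc.Algorithm V n₁ n₂ 𝒢,
              GraphDisc.IsDiscriminating 𝒢 A ε
                ((2 : ℝ) ^ (-((k : ℝ) * Real.logb 2 k)) / 3) →
              c * (√(ρ : ℝ) / (2 ^ (7 * k ^ 3) * ε ^ 2)) ≤ (n₁ : ℝ) + n₂) ∧
          -- testing algorithms
          (2 ≤ ρ → ∀ δ : ℝ, δ < (2 : ℝ) ^ (-((k : ℝ) * Real.logb 2 k)) / 3 →
            ∀ A : GraphDisc.Algorithm V n₁ n₂ GraphDisc.Verdict,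
              GraphDisc.IsTesting 𝒢 A ε δ →
              c * (√(ρ : ℝ) / (2 ^ (7 * k ^ 3) * ε ^ 2)) ≤ (n₁ : ℝ) + n₂) := by
  -- The `20` is twice the `10` of `sqrt_le_of_le_sq`, the fresh tuples taking up half of `√ρ`. The
  -- exponent `38` gives `√ρ ≥ 2 ^ (19 k³)`, enough to dominate them.
  refine ⟨1 / 20, 38, by norm_num, ?_⟩
  intro V _ _ _ k hk 𝒢 ρ hρ ε hε hε1 n₁ n₂
  obtain ⟨K, rfl⟩ : ∃ K, k = K + 1 := ⟨k - 1, by omega⟩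
  obtain ⟨hc1, hc2, hc3⟩ := GraphDisc.sq_le_cube_of_pos hk
  set R : ℝ := 2 ^ K * ((K : ℝ) + 1) ^ (K + 1) with hR
  have hR2 := GraphDisc.two_pow_mul_succ_pow_le K
  -- As `2R ≤ 2 ^ (k²)`, this `τ` survives the polarization loss `R` with a gap of at least `4ε`.
  -- Moreover `k² + 2 ≤ 3k³` gives `τ ≤ 1`, and `2 (k² + 2) ≤ 7k³` gives the factor in the bound.
  set τ : ℝ := 2 ^ ((K + 1) ^ 2 + 2) * ε with hτ
  have hτ0 : 0 ≤ τ := by positivity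
  have hτ1 : τ ≤ 1 := by
    rw [le_div_iff₀ (by positivity)] at hε1
    refine le_trans ?_ hε1
    rw [hτ, mul_comm]
    have : (2 : ℝ) ^ ((K + 1) ^ 2 + 2) ≤ 2 ^ (3 * (K + 1) ^ 3) :=
      pow_le_pow_right₀ (by norm_num) (by omega)
    gcongr
  have hτR : R * (4 * ε) ≤ τ / 2 := by
    have : τ / 2 = 2 * ε * 2 ^ ((K + 1) ^ 2) := by rw [hτ]; ring
    rw [this]
    nlinarith
  have hR0 : 0 < R := by positivity
  have hτsq : τ ^ 2 ≤ 2 ^ (7 * (K + 1) ^ 3) * ε ^ 2 := by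
    rw [hτ, mul_pow, ← pow_mul]
    have : (2 : ℝ) ^ (((K + 1) ^ 2 + 2) * 2) ≤ 2 ^ (7 * (K + 1) ^ 3) :=
      pow_le_pow_right₀ (by norm_num) (by omega)
    gcongr
  have hconf := GraphDisc.two_rpow_neg_mul_logb K
  have hpow := GraphDisc.two_pow_le_succ_pow K
  have hP : 0 < ((K : ℝ) + 1) ^ (K + 1) := by positivity
  refine ⟨fun hbig A hA => ?_, fun h2 δ hδ A hA => ?_⟩
  · have h2 : 2 ≤ ρ := by
      have : (2 : ℝ) ^ 1 ≤ 2 ^ (38 * (K + 1) ^ 3) := pow_le_pow_right₀ (by norm_num) (by omega)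
      exact_mod_cast (pow_one (2 : ℝ) ▸ this).trans hbig
    obtain ⟨m, φ, v, hm, hρm, hsh⟩ := GraphDisc.exists_embedded_cube_of_gVC hρ h2
    -- The factor `64 * 2 ^ K` exceeds the `15 * 2 ^ K` that the summed false alarms require of `M *
    -- ε ^ 2`.
    set x : ℝ := 2 ^ (K + 6) / ε ^ 2 with hx
    have hε2 : 0 < ε ^ 2 := by positivity
    have hε3 : ε ≤ 1 := hε1.trans (by
      rw [div_le_one (by positivity)]
      exact one_le_pow₀ (by norm_num))
    have hx1 : 1 ≤ x := by
      rw [hx, le_div_iff₀ hε2, one_mul]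
      calc ε ^ 2 ≤ 1 := pow_le_one₀ hε.le hε3
        _ ≤ _ := one_le_pow₀ (by norm_num)
    set M : ℕ := ⌈x⌉₊ with hMdef
    have hMx : x ≤ M := Nat.le_ceil x
    have hMle : (M : ℝ) ≤ 2 * x := by
      have := Nat.ceil_lt_add_one (a := x) (by linarith)
      linarith
    have hM0 : 0 < M := by
      have : (0 : ℝ) < M := by linarith
      exact_mod_cast this
    have hMε : 2 ^ (K + 6) ≤ (M : ℝ) * ε ^ 2 := by
      rwa [hx, div_le_iff₀ hε2] at hMx
    have hMε' : (M : ℝ) * ε ^ 2 ≤ 2 ^ (K + 7) := by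
      rw [hx, ← mul_div_assoc, le_div_iff₀ hε2] at hMle
      exact hMle.trans_eq (by ring)
    have hbound := GraphDisc.card_sq_lower_bound_of_isDiscriminating hm hτ0 hτ1 hsh hε
      (by nlinarith) (by
        rw [hconf]
        have := inv_le_one_of_one_le₀ (one_le_pow₀ (n := K + 1)
          (by linarith [Nat.cast_nonneg (α := ℝ) K] : (1 : ℝ) ≤ K + 1))
        linarith) hM0 (by
        rw [mul_one_div, div_le_iff₀ (by positivity)]
        have : (0 : ℝ) < 2 ^ K := by positivity
        have e : (2 : ℝ) ^ (K + 6) = 64 * 2 ^ K := by ring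
        linarith) A hA
    have hs := GraphDisc.sqrt_le_of_le_sq (by positivity) hρm hbound
    -- The fresh tuples account for at most half of `√ρ`, because `M * ε ^ 2` is bounded in terms of
    -- `K` alone.
    have hextra : 20 * (M * ((K : ℝ) + 1)) * τ ^ 2 ≤ √(ρ : ℝ) := by
      have h1 : (2 : ℝ) ^ (19 * (K + 1) ^ 3) ≤ √(ρ : ℝ) := by
        refine Real.le_sqrt_of_sq_le ?_
        rw [← pow_mul]
        exact le_of_eq_of_le (by ring_nf) hbig
      have hK : (K : ℝ) + 1 ≤ 2 ^ K := by exact_mod_cast Nat.lt_two_pow_self (n := K)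
      calc 20 * (M * ((K : ℝ) + 1)) * τ ^ 2 =
          20 * (M * ε ^ 2) * ((K : ℝ) + 1) * 2 ^ (2 * (K + 1) ^ 2 + 4) := by rw [hτ]; ring
        _ ≤ 2 ^ 5 * 2 ^ (K + 7) * 2 ^ K * 2 ^ (2 * (K + 1) ^ 2 + 4) := by gcongr; norm_num
        _ = 2 ^ (5 + (K + 7) + K + (2 * (K + 1) ^ 2 + 4)) := by ring
        _ ≤ 2 ^ (19 * (K + 1) ^ 3) := pow_le_pow_right₀ (by norm_num) (by omega)
        _ ≤ _ := h1
    have hfin : √(ρ : ℝ) ≤ 20 * n₂ * τ ^ 2 := by linarith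
    rw [mul_div_assoc', div_le_iff₀ (by positivity)]
    have hn : (n₂ : ℝ) * τ ^ 2 ≤ (n₁ + n₂) * (2 ^ (7 * (K + 1) ^ 3) * ε ^ 2) := by
      gcongr
      linarith [Nat.cast_nonneg (α := ℝ) n₁]
    linarith
  · obtain ⟨m, φ, v, hm, hρm, hsh⟩ := GraphDisc.exists_embedded_cube_of_gVC hρ h2
    have hbound := GraphDisc.card_sq_lower_bound_of_isTesting hm hτ0 hτ1 hsh
      (ε := ε) (δ := δ) (by nlinarith [mul_pos hR0 hε]) (by
        rw [hconf] at hδ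
        have h1 : (2 : ℝ) ^ K * (((K : ℝ) + 1) ^ (K + 1))⁻¹ ≤ 1 := by
          rw [← div_eq_mul_inv, div_le_one hP]
          exact hpow
        have h2 : (2 : ℝ) ^ K * δ ≤ 2 ^ K * ((((K : ℝ) + 1) ^ (K + 1))⁻¹ / 3) := by gcongr
        linarith) A hA
    have hs := GraphDisc.sqrt_le_of_le_sq (by positivity) hρm hbound
    rw [mul_div_assoc', div_le_iff₀ (by positivity)]
    have hn : (n₂ : ℝ) * τ ^ 2 ≤ (n₁ + n₂) * (2 ^ (7 * (K + 1) ^ 3) * ε ^ 2) := by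
      gcongr
      linarith [Nat.cast_nonneg (α := ℝ) n₁]
    have : 0 ≤ (n₂ : ℝ) * τ ^ 2 := by positivity
    linarith
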